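/- **Theorem 3.5.** The system $\mathsf{Z}_2^\omega$ does not prove $\mathsf{HBC}$. Here: * The language $\mathsf{L}_\omega$ of higher-order arithmetic is the classical many-sorted first-order language with variables and quantifiers for every finite type ($0$ is the type of natural numbers, $\sigma\to\tau$ the type of maps from $\sigma$ to $\tau$, and $n+1$ abbreviates $n\to 0$), with atomic formulas $s=_0t$ and $s<_0t$ for terms of type $0$, and with constants $0,1,+,\times$, the combinators $\Pi,\Sigma$ and recursors $R_\sigma$. Equality at higher types is defined as equality of values at all arguments. * $\mathsf{RCA}_0^\omega$ has as non-logical axioms the discretely ordered semi-ring axioms, the defining axioms of $\Pi$, $\Sigma$ and $R_0$ (that is, $R_0(f,m,0)=m$ and $R_0(f,m,n+1)=f(n,R_0(f,m,n))$), extensionality at all finite types, and, for quantifier-free formulas with parameters of any type, induction and the axiom of choice $(\forall x^1)(\exists y^0)A(x,y)\to(\exists Y^2)(\forall x^1)A(x,Y(x))$. * For $k\ge 0$, $\Pi^1_k\text{-}\mathsf{CA}_0^\omega$ is $\mathsf{RCA}_0^\omega$ plus the axiom that there is a functional $S_k^2\le 1$ such that, for all $f^1$, $S_k(f)=0$ if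 and only if the $\Sigma^1_k$-formula in Kleene normal form $(\exists g_1^1)(\forall g_2^1)\cdots(Q n^0)\,\big(f(\langle\overline{g_1}n,\dots,\overline{g_k}n\rangle)=0\big)$ holds. The quantifiers alternate (including the last, number, quantifier), and $\overline{g}n$ is the code of $\langle g(0),\dots,g(n-1)\rangle$. For $k=0$ the formula is $(\exists n^0)(f(n)=0)$. Finally $\mathsf{Z}_2^\omega=\bigcup_{k}\Pi^1_k\text{-}\mathsf{CA}_0^\omega$. * Real numbers are coded by sequences $(q_n)$ of rationals with $|q_n-q_{n+i}|<2^{-n}$ for all $n,i$, and $x=_{\mathbb R}y$, $x<_{\mathbb R}y$ are defined accordingly. A function $Y:\mathbb R\to\mathbb R$ is an object of type $1\to1$ that maps reals to reals and equal reals to equal reals; it represents the set of the reals $x$ with $Y(x)>_{\mathbb R}0$. A set $C\subseteq\mathbb R$ represented in this way is *closed* if for every real $x\notin C$ there is a rational $r>0$ such that no $y\in C$ satisfies $|x-y|<r$. * $\mathsf{HBC}$ is the sentence of $\mathsf{L}_\omega$ that says: if $C\subseteq[0,1]$ is closed and $(a_n)_{n\in\mathbb N}$, $(b_n)_{n\in\mathbb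 N}$ are sequences of reals such that $C\subseteq\bigcup_{n\in\mathbb N}(a_n,b_n)$, then $C\subseteq\bigcup_{n\le n_0}(a_n,b_n)$ for some $n_0\in\mathbb N$. -/

import Mathlib

/-!
The language of higher-order arithmetic (all finite types), a classical natural deduction
calculus for it, the systems of higher-order reverse mathematics, and the Heine-Borel theorem
for countable coverings of closed sets, as a sentence of that language.

Variables are handled by de Bruijn indices: a context is the list of the types of the free
variables, the most recently bound variable first. Terms are well-typed by construction.
-/

namespace HOA

/-! ### Finite types, terms, formulas -/

/-- The finite types: `0`, and `σ → τ` for finite types `σ` and `τ`. -/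
inductive Ty : Type
  | zero : Ty
  | arr : Ty → Ty → Ty

infixr:60 " ⇒ " => Ty.arr

/-- The type `0` of natural numbers. -/
abbrev N : Ty := Ty.zero

/-- The type `1 = 0 → 0` of functions on the natural numbers. -/
abbrev N1 : Ty := N ⇒ N

/-- The type `2 = 1 → 0`. -/
abbrev N2 : Ty := N1 ⇒ N

/-- A variable of type `σ` in a context. -/
inductive Var : List Ty → Ty → Type
  | z {Γ : List Ty} {σ : Ty} : Var (σ :: Γ) σ
  | s {Γ : List Ty} {σ τ : Ty} : Var Γ σ → Var (τ :: Γ) σ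

/-- The constants: `0`, `1`, `+`, `×`, the combinators `Π` and `Σ` and the recursors `R_σ`.
The base theory has a law for `R_0` only. -/
inductive Const : Ty → Type
  | zero : Const N
  | one : Const N
  | add : Const (N ⇒ N ⇒ N)
  | mul : Const (N ⇒ N ⇒ N)
  | pi (σ τ : Ty) : Const (σ ⇒ τ ⇒ σ)
  | sigma (ρ σ τ : Ty) : Const ((ρ ⇒ σ ⇒ τ) ⇒ (ρ ⇒ σ) ⇒ ρ ⇒ τ)
  | recr (σ : Ty) : Const ((N ⇒ σ ⇒ σ) ⇒ σ ⇒ N ⇒ σ)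

/-- The terms of a given type over a context. -/
inductive Term (Γ : List Ty) : Ty → Type
  | var {σ : Ty} : Var Γ σ → Term Γ σ
  | const {σ : Ty} : Const σ → Term Γ σ
  | app {σ τ : Ty} : Term Γ (σ ⇒ τ) → Term Γ σ → Term Γ τ

/-- The formulas over a context. The atomic formulas are equations and inequalities between
terms of type `0`; there are quantifiers over each finite type. Negation, conjunction,
disjunction, equivalence and existential quantification are defined classically below. -/
inductive Formula : List Ty → Type
  | falsum {Γ : List Ty} : Formula Γ
  | eq {Γ : List Ty} : Term Γ N → Term Γ N → Formula Γ
  | lt {Γ : List Ty} : Term Γ N → Term Γ N → Formula Γ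
  | imp {Γ : List Ty} : Formula Γ → Formula Γ → Formula Γ
  | all {Γ : List Ty} (σ : Ty) : Formula (σ :: Γ) → Formula Γ

/-- A sentence is a formula without free variables. -/
abbrev Sentence : Type := Formula []

/-! ### Substitution -/

/-- A simultaneous substitution of terms over `Δ` for the variables of `Γ`. -/
abbrev Subst (Γ Δ : List Ty) : Type := ∀ σ : Ty, Var Γ σ → Term Δ σ

namespace Term

def subst {Γ Δ : List Ty} (f : Subst Γ Δ) : {σ : Ty} → Term Γ σ → Term Δ σ
  | _, var x => f _ x
  | _, const c => const c
  | _, app s t => app (subst f s) (subst f t)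

/-- Weakening: the same term, with one more variable in the context. -/
def wk {Γ : List Ty} {σ τ : Ty} (t : Term Γ σ) : Term (τ :: Γ) σ :=
  t.subst (fun _ x => var (Var.s x))

end Term

/-- The substitution `f` under a quantifier. -/
def Subst.lift {Γ Δ : List Ty} (f : Subst Γ Δ) (τ : Ty) : Subst (τ :: Γ) (τ :: Δ)
  | _, Var.z => Term.var Var.z
  | _, Var.s x => (f _ x).wk

/-- The substitution of `t` for the most recent variable. -/
def Subst.single {Γ : List Ty} {τ : Ty} (t : Term Γ τ) : Subst (τ :: Γ) Γ
  | _, Var.z => t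
  | _, Var.s x => Term.var x

/-- The substitution for no variables. -/
def Subst.empty {Γ : List Ty} : Subst [] Γ := fun _ x => nomatch x

namespace Formula

def subst : {Γ Δ : List Ty} → Subst Γ Δ → Formula Γ → Formula Δ
  | _, _, _, falsum => falsum
  | _, _, f, eq s t => eq (s.subst f) (t.subst f)
  | _, _, f, lt s t => lt (s.subst f) (t.subst f)
  | _, _, f, imp φ ψ => imp (subst f φ) (subst f ψ)
  | _, _, f, all σ φ => all σ (subst (f.lift σ) φ)

/-- Weakening: the same formula, with one more variable in the context. -/
def wk {Γ : List Ty} {τ : Ty} (φ : Formula Γ) : Formula (τ :: Γ) :=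
  φ.subst (fun _ x => Term.var (Var.s x))

/-- The formula `φ(t)`, where `φ(x)` has the most recent variable `x`. -/
def inst {Γ : List Ty} {τ : Ty} (φ : Formula (τ :: Γ)) (t : Term Γ τ) : Formula Γ :=
  φ.subst (Subst.single t)

/-- A sentence, as a formula over any context. -/
def ofSentence {Γ : List Ty} (φ : Sentence) : Formula Γ :=
  φ.subst Subst.empty

/-- The universal closure. -/
def close : {Γ : List Ty} → Formula Γ → Sentence
  | [], φ => φ
  | σ :: _, φ => close (all σ φ)

def neg {Γ : List Ty} (φ : Formula Γ) : Formula Γ := imp φ falsum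

def and {Γ : List Ty} (φ ψ : Formula Γ) : Formula Γ := neg (imp φ (neg ψ))

def or {Γ : List Ty} (φ ψ : Formula Γ) : Formula Γ := imp (neg φ) ψ

def iff {Γ : List Ty} (φ ψ : Formula Γ) : Formula Γ := and (imp φ ψ) (imp ψ φ)

def ex {Γ : List Ty} (σ : Ty) (φ : Formula (σ :: Γ)) : Formula Γ := neg (all σ (neg φ))

/-- `s ≤ t` at type `0`. -/
def le {Γ : List Ty} (s t : Term Γ N) : Formula Γ := or (lt s t) (eq s t)

/-- Equality at an arbitrary finite type: equality at type `0` for all arguments. -/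
def eqT {Γ : List Ty} : (τ : Ty) → Term Γ τ → Term Γ τ → Formula Γ
  | Ty.zero, s, t => eq s t
  | Ty.arr σ τ, s, t =>
      all σ (eqT τ (Term.app s.wk (Term.var Var.z)) (Term.app t.wk (Term.var Var.z)))

/-- A formula without quantifiers, over any finite type. It may have parameters of any type. -/
def IsQF : {Γ : List Ty} → Formula Γ → Prop
  | _, falsum => True
  | _, eq _ _ => True
  | _, lt _ _ => True
  | _, imp φ ψ => IsQF φ ∧ IsQF ψ
  | _, all _ _ => False

end Formula

/-! ### Provability -/

/-- Classical natural deduction. `Derives T Δ φ` says that `φ` is derivable from the hypotheses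
`Δ` and the sentences of `T`; all of these formulas have their free variables in the context. -/
inductive Derives (T : Set Sentence) : {Γ : List Ty} → List (Formula Γ) → Formula Γ → Prop
  | thy {Γ : List Ty} {Δ : List (Formula Γ)} {φ : Sentence} :
      φ ∈ T → Derives T Δ φ.ofSentence
  | hyp {Γ : List Ty} {Δ : List (Formula Γ)} {φ : Formula Γ} :
      φ ∈ Δ → Derives T Δ φ
  | impI {Γ : List Ty} {Δ : List (Formula Γ)} {φ ψ : Formula Γ} :
      Derives T (φ :: Δ) ψ → Derives T Δ (φ.imp ψ)
  | impE {Γ : List Ty} {Δ : List (Formula Γ)} {φ ψ : Formula Γ} :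
      Derives T Δ (φ.imp ψ) → Derives T Δ φ → Derives T Δ ψ
  | raa {Γ : List Ty} {Δ : List (Formula Γ)} {φ : Formula Γ} :
      Derives T (φ.neg :: Δ) Formula.falsum → Derives T Δ φ
  | allI {Γ : List Ty} {Δ : List (Formula Γ)} {σ : Ty} {φ : Formula (σ :: Γ)} :
      Derives T (Δ.map Formula.wk) φ → Derives T Δ (Formula.all σ φ)
  | allE {Γ : List Ty} {Δ : List (Formula Γ)} {σ : Ty} {φ : Formula (σ :: Γ)} (t : Term Γ σ) :
      Derives T Δ (Formula.all σ φ) → Derives T Δ (φ.inst t)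
  | eqRefl {Γ : List Ty} {Δ : List (Formula Γ)} (t : Term Γ N) :
      Derives T Δ (Formula.eq t t)
  | eqSubst {Γ : List Ty} {Δ : List (Formula Γ)} {s t : Term Γ N} (φ : Formula (N :: Γ)) :
      Derives T Δ (Formula.eq s t) → Derives T Δ (φ.inst s) → Derives T Δ (φ.inst t)

/-- The theory `T` proves the sentence `φ`. -/
def Proves (T : Set Sentence) (φ : Sentence) : Prop := Derives T [] φ

/-! ### Term notation -/

section
variable {Γ : List Ty}

instance : Zero (Term Γ N) := ⟨Term.const Const.zero⟩
instance : One (Term Γ N) := ⟨Term.const Const.one⟩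
instance : Add (Term Γ N) := ⟨fun s t => Term.app (Term.app (Term.const Const.add) s) t⟩
instance : Mul (Term Γ N) := ⟨fun s t => Term.app (Term.app (Term.const Const.mul) s) t⟩

/-- Application of a term to an argument. -/
instance {σ τ : Ty} : CoeFun (Term Γ (σ ⇒ τ)) (fun _ => Term Γ σ → Term Γ τ) := ⟨Term.app⟩

abbrev v0 {a : Ty} : Term (a :: Γ) a := Term.var Var.z
abbrev v1 {a b : Ty} : Term (b :: a :: Γ) a := Term.var (Var.s Var.z)
abbrev v2 {a b c : Ty} : Term (c :: b :: a :: Γ) a := Term.var (Var.s (Var.s Var.z))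
abbrev v3 {a b c d : Ty} : Term (d :: c :: b :: a :: Γ) a :=
  Term.var (Var.s (Var.s (Var.s Var.z)))

/-- `Π` and `Σ` as terms. -/
abbrev cK (σ τ : Ty) : Term Γ (σ ⇒ τ ⇒ σ) := Term.const (Const.pi σ τ)
abbrev cS (ρ σ τ : Ty) : Term Γ ((ρ ⇒ σ ⇒ τ) ⇒ (ρ ⇒ σ) ⇒ ρ ⇒ τ) :=
  Term.const (Const.sigma ρ σ τ)

/-- Lambda abstraction, defined from the combinators. -/
def lam {σ : Ty} : {τ : Ty} → Term (σ :: Γ) τ → Term Γ (σ ⇒ τ)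
  | _, Term.var Var.z => cS σ (σ ⇒ σ) σ (cK σ (σ ⇒ σ)) (cK σ σ)
  | _, Term.var (Var.s x) => cK _ σ (Term.var x)
  | _, Term.const c => cK _ σ (Term.const c)
  | _, Term.app s t => cS σ _ _ (lam s) (lam t)

/-- The term `R_0(f, m, n)`. -/
def recN (f : Term Γ (N ⇒ N ⇒ N)) (m n : Term Γ N) : Term Γ N :=
  Term.const (Const.recr N) f m n

end

/-! ### The base theory -/

/-- The discretely ordered semi-ring laws for `0, 1, <, +, ×`. -/
inductive IsArith : Formula [N, N, N] → Prop
  | addAssoc : IsArith (.eq ((v0 + v1) + v2) (v0 + (v1 + v2)))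
  | addComm : IsArith (.eq (v0 + v1) (v1 + v0))
  | addZero : IsArith (.eq (v0 + 0) v0)
  | mulAssoc : IsArith (.eq ((v0 * v1) * v2) (v0 * (v1 * v2)))
  | mulComm : IsArith (.eq (v0 * v1) (v1 * v0))
  | mulOne : IsArith (.eq (v0 * 1) v0)
  | mulZero : IsArith (.eq (v0 * 0) 0)
  | distrib : IsArith (.eq (v0 * (v1 + v2)) (v0 * v1 + v0 * v2))
  | ltIrrefl : IsArith (.neg (.lt v0 v0))
  | ltTrans : IsArith (.imp (.lt v0 v1) (.imp (.lt v1 v2) (.lt v0 v2)))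
  | ltTotal : IsArith (.or (.lt v0 v1) (.or (.eq v0 v1) (.lt v1 v0)))
  | addMono : IsArith (.imp (.lt v0 v1) (.lt (v0 + v2) (v1 + v2)))
  | mulMono : IsArith (.imp (.lt 0 v2) (.imp (.lt v0 v1) (.lt (v0 * v2) (v1 * v2))))
  | diff : IsArith (.imp (.lt v0 v1) (.ex N (.eq (v1 + v0) v2)))
  | zeroLtOne : IsArith (.lt 0 1)
  | discrete : IsArith (.imp (.lt 0 v0) (.le 1 v0))
  | nonneg : IsArith (.le 0 v0)

/-- The substitution of `n + 1` for the most recent variable `n`. -/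
def Subst.succ {Γ : List Ty} : Subst (N :: Γ) (N :: Γ)
  | _, Var.z => (v0 + 1 : Term (N :: Γ) N)
  | _, Var.s x => Term.var (Var.s x)

/-- The substitution of `Y(x)` for the most recent variable `y`, where `x` is the variable before
it, and where the new variable `Y` is put before `x`. -/
def Subst.skolem {Γ : List Ty} : Subst (N :: N1 :: Γ) (N1 :: N2 :: Γ)
  | _, Var.z => (v1 : Term (N1 :: N2 :: Γ) N2) v0
  | _, Var.s Var.z => v0
  | _, Var.s (Var.s x) => Term.var (Var.s (Var.s x))

/-- Induction for the formula `A(n)`, where `n` is the most recent variable. -/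
def induction {Γ : List Ty} (A : Formula (N :: Γ)) : Formula Γ :=
  .imp (A.inst 0)
    (.imp (.all N (.imp A (A.subst Subst.succ)))
      (.all N A))

/-- `(∀ x^1)(∃ y^0) A(x, y) → (∃ Y^2)(∀ x^1) A(x, Y(x))`, where `y` is the most
recent variable of `A` and `x` the variable before it. -/
def choice10 {Γ : List Ty} (A : Formula (N :: N1 :: Γ)) : Formula Γ :=
  .imp (.all N1 (.ex N A))
    (.ex N2 (.all N1 (A.subst Subst.skolem)))

/-- The base theory `RCA_0^ω`. -/
inductive RCA0ω : Set Sentence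
  | arith {φ : Formula [N, N, N]} : IsArith φ → RCA0ω φ.close
  /-- `Π x y = x` -/
  | pi (σ τ : Ty) : RCA0ω (Formula.close (Γ := [σ, τ])
      (.eqT σ (cK σ τ v0 v1) v0))
  /-- `Σ x y z = x z (y z)` -/
  | sigma (ρ σ τ : Ty) : RCA0ω (Formula.close (Γ := [ρ ⇒ σ ⇒ τ, ρ ⇒ σ, ρ])
      (.eqT τ (cS ρ σ τ v0 v1 v2) ((v0 : Term _ (ρ ⇒ σ ⇒ τ)) v2 ((v1 : Term _ (ρ ⇒ σ)) v2))))
  /-- `R_0(f, m, 0) = m` -/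
  | recZero : RCA0ω (Formula.close (Γ := [N ⇒ N ⇒ N, N])
      (.eq (recN v0 v1 0) v1))
  /-- `R_0(f, m, n + 1) = f(n, R_0(f, m, n))` -/
  | recSucc : RCA0ω (Formula.close (Γ := [N ⇒ N ⇒ N, N, N])
      (.eq (recN v0 v1 (v2 + 1)) ((v0 : Term _ (N ⇒ N ⇒ N)) v2 (recN v0 v1 v2))))
  /-- extensionality, at all finite types -/
  | ext (ρ τ : Ty) : RCA0ω (Formula.close (Γ := [ρ, ρ, ρ ⇒ τ])
      (.imp (.eqT ρ v0 v1) (.eqT τ ((v2 : Term _ (ρ ⇒ τ)) v0) ((v2 : Term _ (ρ ⇒ τ)) v1))))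
  /-- quantifier-free induction, with parameters of all types -/
  | ind {Γ : List Ty} (A : Formula (N :: Γ)) : A.IsQF → RCA0ω (induction A).close
  /-- the quantifier-free axiom of choice `QF-AC^{1,0}`, with parameters of all types -/
  | choice {Γ : List Ty} (A : Formula (N :: N1 :: Γ)) : A.IsQF → RCA0ω (choice10 A).close

/-! ### Coding of pairs, sequences and rationals by closed terms -/

section
variable {Γ : List Ty}

/-- `2 ^ n` -/
def pow2 (n : Term Γ N) : Term Γ N := recN (lam (lam (v0 + v0))) 1 n

/-- the predecessor -/
def pred (n : Term Γ N) : Term Γ N := recN (lam (lam v1)) 0 n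

/-- truncated subtraction -/
def monus (m n : Term Γ N) : Term Γ N := recN (lam (lam (pred v0))) m n

/-- `n (n + 1) / 2` -/
def tri (n : Term Γ N) : Term Γ N := recN (lam (lam (v0 + (v1 + 1)))) 0 n

/-- The Cantor pairing `(m + n) (m + n + 1) / 2 + m`. -/
def pair (m n : Term Γ N) : Term Γ N := tri (m + n) + m

/-- The sum of the components of the pair with code `c`: the largest `w` with `tri w ≤ c`. -/
def pairSum (c : Term Γ N) : Term Γ N :=
  recN (lam (lam (v0 + monus 1 (monus (tri (v0 + 1)) (v1 + 1))))) 0 c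

def fst (c : Term Γ N) : Term Γ N := monus c (tri (pairSum c))

def snd (c : Term Γ N) : Term Γ N := monus (pairSum c) (fst c)

/-- `0` for even `n`, `1` for odd `n` -/
def parity (n : Term Γ N) : Term Γ N := recN (lam (lam (monus 1 v0))) 0 n

/-- `n / 2`, rounded down -/
def half (n : Term Γ N) : Term Γ N := recN (lam (lam (v0 + parity v1))) 0 n

/-- The code of the finite sequence `g(0), …, g(n - 1)`: the empty sequence has code `0`, and
the extension of the sequence with code `c` by `a` has code `pair c a + 1`. -/
def bar (g : Term Γ N1) (n : Term Γ N) : Term Γ N :=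
  recN (lam (lam (pair v0 (g.wk.wk v1) + 1))) 0 n

/-- The code of the initial segments of length `n` of a list of functions (`n` itself if the list
is empty). -/
def barTuple (n : Term Γ N) : List (Term Γ N1) → Term Γ N
  | [] => n
  | [g] => bar g n
  | g :: h :: gs => pair (bar g n) (barTuple n (h :: gs))

end

/-! ### The functionals `S_k^2` and the systems `Π_k^1-CA_0^ω` -/

/-- A formula that starts with `k` alternating quantifiers over functions, the first of them
existential if and only if `e` is true, followed by a number quantifier that continues the
alternation and by a matrix given by the function `f`, which is applied to the initial segments
of length `n` of the functions `gs` and of the quantified functions. -/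
def kleene : {Γ : List Ty} → (k : ℕ) → (e : Bool) → Term Γ N1 → List (Term Γ N1) → Formula Γ
  | _, 0, true, f, gs => .ex N (.eq (f.wk (barTuple v0 (gs.map Term.wk))) 0)
  | _, 0, false, f, gs => .all N (.eq (f.wk (barTuple v0 (gs.map Term.wk))) 0)
  | _, k + 1, true, f, gs => .ex N1 (kleene k false f.wk (gs.map Term.wk ++ [v0]))
  | _, k + 1, false, f, gs => .all N1 (kleene k true f.wk (gs.map Term.wk ++ [v0]))

/-- The `Σ_k^1`-formula with parameter `f`, in Kleene normal form
`(∃ g_1)(∀ g_2) … (f(⟨g_1 restricted to n, …, g_k restricted to n⟩) = 0)`. For `k = 0` it is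
`(∃ n)(f(n) = 0)`, for `k = 1` it is `(∃ g)(∀ n)(f(g restricted to n) = 0)`. -/
def sigmaForm {Γ : List Ty} (k : ℕ) (f : Term Γ N1) : Formula Γ := kleene k true f []

/-- The sentence `(S_k^2)`: there is `S^2 ≤ 1` such that `S(f) = 0` if and only if the
`Σ_k^1`-formula with parameter `f` holds, for all `f^1`. -/
def existsS (k : ℕ) : Sentence :=
  .ex N2 (.and
    (.all N1 (.le ((v1 : Term _ N2) v0) 1))
    (.all N1 (.iff (sigmaForm k v0) (.eq ((v1 : Term _ N2) v0) 0))))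

/-- The system `Π_k^1-CA_0^ω`; for `k = 0` it is `ACA_0^ω`. -/
def PiCA0ω (k : ℕ) : Set Sentence := RCA0ω ∪ {existsS k}

/-- The system `Z_2^ω`. -/
def Z2ω : Set Sentence := ⋃ k : ℕ, PiCA0ω k

/-! ### Rational and real numbers -/

/-- A signed quotient `(pos - neg) / den` of terms for natural numbers; the terms `den` that
occur below are positive. -/
structure QTerm (Γ : List Ty) where
  pos : Term Γ N
  neg : Term Γ N
  den : Term Γ N

section
variable {Γ : List Ty}

namespace QTerm

/-- The rational with code `c = pair n m`: it is `(n / 2) / (m + 1)` for even `n`, and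
`- ((n + 1) / 2) / (m + 1)` for odd `n`. -/
def ofCode (c : Term Γ N) : QTerm Γ where
  pos := monus 1 (parity (fst c)) * half (fst c)
  neg := parity (fst c) * (half (fst c) + 1)
  den := snd c + 1

/-- the rational `0` -/
def zero : QTerm Γ := ⟨0, 0, 1⟩

/-- the rational `2 ^ (- n)` -/
def twoNeg (n : Term Γ N) : QTerm Γ := ⟨1, 0, pow2 n⟩

/-- the rational `2 ^ (- n + 1)` -/
def twoNegAddOne (n : Term Γ N) : QTerm Γ := ⟨1 + 1, 0, pow2 n⟩

def opp (p : QTerm Γ) : QTerm Γ := ⟨p.neg, p.pos, p.den⟩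

def add (p q : QTerm Γ) : QTerm Γ :=
  ⟨p.pos * q.den + q.pos * p.den, p.neg * q.den + q.neg * p.den, p.den * q.den⟩

def sub (p q : QTerm Γ) : QTerm Γ := p.add q.opp

/-- `p < q` -/
def lt (p q : QTerm Γ) : Formula Γ :=
  .lt (p.pos * q.den + q.neg * p.den) (q.pos * p.den + p.neg * q.den)

/-- `p ≤ q` -/
def le (p q : QTerm Γ) : Formula Γ :=
  .le (p.pos * q.den + q.neg * p.den) (q.pos * p.den + p.neg * q.den)

/-- `|p| < q` -/
def absLt (p q : QTerm Γ) : Formula Γ := .and (p.lt q) (p.opp.lt q)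

/-- `|p| ≤ q` -/
def absLe (p q : QTerm Γ) : Formula Γ := .and (p.le q) (p.opp.le q)

end QTerm

/-- The `n`-th approximation of the real number represented by `x`. -/
def approx (x : Term Γ N1) (n : Term Γ N) : QTerm Γ := QTerm.ofCode (x n)

/-- `x ∈ ℝ`: the sequence of rationals coded by `x` converges fast, that is,
`|x_n - x_{n+i}| < 2 ^ (- n)` for all `n` and `i`. -/
def isReal (x : Term Γ N1) : Formula Γ :=
  .all N (.all N
    (((approx x.wk.wk v1).sub (approx x.wk.wk (v1 + v0))).absLt (QTerm.twoNeg v1)))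

/-- `x = y` for reals: `|x_n - y_n| ≤ 2 ^ (- n + 1)` for all `n`. -/
def realEq (x y : Term Γ N1) : Formula Γ :=
  .all N (((approx x.wk v0).sub (approx y.wk v0)).absLe (QTerm.twoNegAddOne v0))

/-- `x < y` for reals: `x_n + 2 ^ (- n + 1) < y_n` for some `n`. -/
def realLt (x y : Term Γ N1) : Formula Γ :=
  .ex N (((approx x.wk v0).add (QTerm.twoNegAddOne v0)).lt (approx y.wk v0))

/-- `|x - y| < r` for reals `x` and `y` and a rational with code `r`:
`|x_n - y_n| < r - 2 ^ (- n + 1)` for some `n`. -/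
def distLt (x y : Term Γ N1) (r : Term Γ N) : Formula Γ :=
  .ex N (((approx x.wk v0).sub (approx y.wk v0)).absLt
    ((QTerm.ofCode r.wk).sub (QTerm.twoNegAddOne v0)))

/-- `φ(x)` holds for all reals `x` (the most recent variable). -/
def allReal (φ : Formula (N1 :: Γ)) : Formula Γ := .all N1 (.imp (isReal v0) φ)

/-- The real with the constant sequence of approximations with code `c`. -/
def constReal (c : Term Γ N) : Term Γ N1 := cK N N c

/-- The real `0` (the rational `0` has code `0 = pair 0 0`). -/
def realZero : Term Γ N1 := constReal 0

/-- The real `1` (the rational `1` has the code `pair 2 0`). -/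
def realOne : Term Γ N1 := constReal (pair (1 + 1) 0)

/-- `Y` represents a function from `ℝ` to `ℝ`: it maps reals to reals, and equal reals to equal
reals. -/
def isRealFun (Y : Term Γ (N1 ⇒ N1)) : Formula Γ :=
  .and (allReal (isReal (Y.wk v0)))
    (allReal (allReal (.imp (realEq v1 v0) (realEq (Y.wk.wk v1) (Y.wk.wk v0)))))

/-! ### The Heine-Borel theorem for countable coverings of closed sets -/

/-- `x ∈ Y`, for the set represented by `Y : ℝ → ℝ`: `Y(x) > 0`. -/
def mem (x : Term Γ N1) (Y : Term Γ (N1 ⇒ N1)) : Formula Γ := realLt realZero (Y x)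

/-- The set represented by `Y` is closed: each real outside of it is the centre of a ball, of a
rational radius `r > 0`, that is contained in the complement. -/
def isClosed (Y : Term Γ (N1 ⇒ N1)) : Formula Γ :=
  allReal (.imp (.neg (mem v0 Y.wk))
    (.ex N (.and (QTerm.zero.lt (QTerm.ofCode v0))
      (allReal (.imp (distLt v2 v0 v1) (.neg (mem v0 Y.wk.wk.wk)))))))

/-- The set represented by `Y` is contained in `[0, 1]`. -/
def inUnitInterval (Y : Term Γ (N1 ⇒ N1)) : Formula Γ :=
  allReal (.imp (mem v0 Y.wk)
    (.and (.neg (realLt v0 realZero)) (.neg (realLt realOne v0))))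

/-- `a` is a sequence of reals. -/
def isRealSeq (a : Term Γ (N ⇒ N1)) : Formula Γ := .all N (isReal (a.wk v0))

/-- `x ∈ (a_n, b_n)` -/
def inInterval (x : Term Γ N1) (a b : Term Γ (N ⇒ N1)) (n : Term Γ N) : Formula Γ :=
  .and (realLt (a n) x) (realLt x (b n))

/-- The intervals `(a_n, b_n)` for all `n` cover the set represented by `Y`. -/
def covers (Y : Term Γ (N1 ⇒ N1)) (a b : Term Γ (N ⇒ N1)) : Formula Γ :=
  allReal (.imp (mem v0 Y.wk) (.ex N (inInterval v1 a.wk.wk b.wk.wk v0)))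

/-- The intervals `(a_n, b_n)` for `n ≤ m` cover the set represented by `Y`. -/
def coversUpTo (Y : Term Γ (N1 ⇒ N1)) (a b : Term Γ (N ⇒ N1)) (m : Term Γ N) : Formula Γ :=
  allReal (.imp (mem v0 Y.wk)
    (.ex N (.and (.le v0 m.wk.wk) (inInterval v1 a.wk.wk b.wk.wk v0))))

end

/-- The sentence `HBC`: if the closed set represented by `Y` is contained in `[0, 1]` and covered
by the intervals `(a_n, b_n)`, then it is covered by finitely many of them. -/
def HBC : Sentence :=
  .all (N1 ⇒ N1) (.imp (isRealFun v0) (.imp (isClosed v0) (.imp (inUnitInterval v0)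
    (.all (N ⇒ N1) (.all (N ⇒ N1) (.imp (isRealSeq v1) (.imp (isRealSeq v0)
      (.imp (covers v2 v1 v0)
        (.ex N (coversUpTo v3 v2 v1 v0))))))))))

end HOA

/-!
The theorem holds because of a model of `Z_2^ω`, with the standard natural numbers, in which the
Heine-Borel theorem fails for a closed set that no sequence of the model enumerates.

The functions on `ℕ` of the model are the union of a chain `A_0 ⊆ A_1 ⊆ …` of countable sets.
Each `A_n` is closed under relative computability, under Skolem functions for the formulas in
Kleene normal form, and under the jumps that decide these formulas (`exists_isGoodChain`). So the
union is an elementary submodel of the set of all functions (`IsClosedSet.kleeneTrue_iff`), and its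
functionals `S_k` agree with the true ones and act on each `A_n` separately.

The higher types are interpreted in a cartesian closed category of sets with plots (`Space`). A
plot of level `n` in `ℕ` is an element of `A_n`, and a functional belongs to the model if, from some
level on, it maps plots to plots of the same level. Hence the functions of type `1` are exactly
those of the chain, equality is extensional, and a functional is allowed to act on each level in a
way that depends on the level, provided that it is computable within this level. This yields
soundness (`Derives.sound`), the axioms of the base theory (`sat_RCA0ω`; quantifier-free choice is
unbounded search) and the functionals `S_k` (`sat_existsS`).

In particular a set `C = {y_0, y_1, …}` of reals of the model is represented by a functional as soon
as `y_m` has no code in `A_m` (`exists_represents`): on the reals of level `n`, membership in `C` is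
equality with one of `y_0, …, y_{n-1}`, a finite list of parameters of level `n`. Take open intervals
with rational endpoints around all rationals, of total length at most `1 / 2`, and an irrational
`z` in `(0, 1)` outside of them that is not in the model. The new reals of each level are dense, so
that there are such `y_m` in the union of the intervals that converge to `z`. In the model `C` is
closed, since its only accumulation point is missing. The intervals cover `C`, but finitely many of
them do not, as `z` has a positive distance to each of them (`exists_model_not_HBC`).
-/

namespace HOA

/-! ### Sets of functions closed under recursion -/

/-- A set of functions on `ℕ` that contains the primitive recursive functions and is closed under
composition, pairing, primitive recursion and unbounded search; that is, a set closed under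
relative computability of total functions. Unbounded search is total, with the junk value `0`. -/
structure RecClosed (s : Set (ℕ → ℕ)) : Prop where
  primrec : ∀ f, Nat.Primrec f → f ∈ s
  comp : ∀ f ∈ s, ∀ g ∈ s, (fun i => f (g i)) ∈ s
  pair : ∀ f ∈ s, ∀ g ∈ s, (fun i => Nat.pair (f i) (g i)) ∈ s
  prec : ∀ f ∈ s, ∀ g ∈ s, (fun a : ℕ => Nat.rec (motive := fun _ => ℕ) (f a.unpair.1)
    (fun y r => g (Nat.pair a.unpair.1 (Nat.pair y r))) a.unpair.2) ∈ s
  search : ∀ f ∈ s, (fun a => sInf {n | f (Nat.pair a n) = 0}) ∈ s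

namespace RecClosed
variable {s : Set (ℕ → ℕ)} (hs : RecClosed s)
include hs

theorem of_primrec {f : ℕ → ℕ} (hf : Primrec f) : f ∈ s :=
  hs.primrec f (Primrec.nat_iff.1 hf)

theorem const (c : ℕ) : (fun _ => c) ∈ s := hs.of_primrec (Primrec.const c)

theorem id : (fun i : ℕ => i) ∈ s := hs.of_primrec Primrec.id

theorem left : (fun i : ℕ => i.unpair.1) ∈ s :=
  hs.of_primrec (Primrec.fst.comp Primrec.unpair)

theorem right : (fun i : ℕ => i.unpair.2) ∈ s :=
  hs.of_primrec (Primrec.snd.comp Primrec.unpair)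

theorem uncurried {p : ℕ → ℕ → ℕ} (hp : (fun n : ℕ => p n.unpair.1 n.unpair.2) ∈ s)
    {f g : ℕ → ℕ} (hf : f ∈ s) (hg : g ∈ s) : (fun i => p (f i) (g i)) ∈ s := by
  simpa using hs.comp _ hp _ (hs.pair f hf g hg)

theorem comp₂ {p : ℕ → ℕ → ℕ} (hp : Primrec₂ p) {f g : ℕ → ℕ} (hf : f ∈ s) (hg : g ∈ s) :
    (fun i => p (f i) (g i)) ∈ s :=
  hs.uncurried (hs.of_primrec
    (hp.comp (Primrec.fst.comp Primrec.unpair) (Primrec.snd.comp Primrec.unpair))) hf hg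

theorem natRec {f a b : ℕ → ℕ} (hf : f ∈ s) (ha : a ∈ s) (hb : b ∈ s) :
    (fun i => Nat.rec (motive := fun _ => ℕ) (a i)
      (fun y r => f (Nat.pair i (Nat.pair y r))) (b i)) ∈ s := by
  simpa using hs.comp _ (hs.prec a ha f hf) _ (hs.pair _ hs.id b hb)

end RecClosed

/-- An increasing sequence of sets of functions that are closed under recursion. -/
structure Chain where
  level : ℕ → Set (ℕ → ℕ)
  mono : Monotone level
  closed : ∀ n, RecClosed (level n)

/-! ### The category of spaces with plots -/

/-- A set together with, for each level `n`, a class of sequences in it, the plots of level `n`.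
Each point has to be the value of a constant plot, and plots may be reparametrized along the
functions of their level. -/
structure Space (𝒜 : Chain) where
  carrier : Type
  plot : ℕ → (ℕ → carrier) → Prop
  mono : ∀ {m n x}, m ≤ n → plot m x → plot n x
  reparam : ∀ {n x h}, plot n x → h ∈ 𝒜.level n → plot n (fun i => x (h i))
  const : ∀ a, ∃ n, plot n (fun _ => a)

namespace Space
variable {𝒜 : Chain}

/-- The natural numbers; the plots of level `n` are the functions of level `n`. -/
def nat (𝒜 : Chain) : Space 𝒜 where
  carrier := ℕ
  plot n x := x ∈ 𝒜.level n
  mono h hx := 𝒜.mono h hx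
  reparam hx hh := (𝒜.closed _).comp _ hx _ hh
  const a := ⟨0, (𝒜.closed 0).const a⟩

/-- The exponential: its points are the functions that preserve plots from some level on. -/
def arr (X Y : Space 𝒜) : Space 𝒜 where
  carrier := {F : X.carrier → Y.carrier //
    ∃ n, ∀ m, n ≤ m → ∀ x, X.plot m x → Y.plot m (fun i => F (x i))}
  plot n F := ∀ m, n ≤ m → ∀ h ∈ 𝒜.level m, ∀ x, X.plot m x →
    Y.plot m (fun i => (F (h i)).1 (x i))
  mono h hF := fun m hm => hF m (h.trans hm)
  reparam hF hg := fun m hm h hh x hx =>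
    hF m hm _ ((𝒜.closed m).comp _ (𝒜.mono hm hg) _ hh) x hx
  const F := by
    obtain ⟨n, hn⟩ := F.2
    exact ⟨n, fun m hm _ _ x hx => hn m hm x hx⟩

variable {X Y Z W : Space 𝒜}

theorem plot_app {F : ℕ → (arr X Y).carrier} {x : ℕ → X.carrier} {n : ℕ}
    (hF : (arr X Y).plot n F) (hx : X.plot n x) : Y.plot n (fun i => (F i).1 (x i)) :=
  hF n le_rfl _ (𝒜.closed n).id x hx

/-- A binary operation that preserves plots, as a point of the iterated exponential. -/
def curry₂ (f : X.carrier → Y.carrier → Z.carrier)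
    (hf : ∃ n, ∀ m, n ≤ m → ∀ x y, X.plot m x → Y.plot m y → Z.plot m (fun i => f (x i) (y i))) :
    (arr X (arr Y Z)).carrier :=
  ⟨fun x => ⟨f x, by
    obtain ⟨n, hn⟩ := hf
    obtain ⟨k, hk⟩ := X.const x
    exact ⟨max n k, fun m hm y hy =>
      hn m (le_of_max_le_left hm) _ y (X.mono (le_of_max_le_right hm) hk) hy⟩⟩, by
    obtain ⟨n, hn⟩ := hf
    exact ⟨n, fun m hm x hx m' hm' h hh y hy =>
      hn m' (hm.trans hm') (fun i => x (h i)) y (X.reparam (X.mono hm' hx) hh) hy⟩⟩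

/-- A ternary operation that preserves plots, as a point of the iterated exponential. -/
def curry₃ (f : X.carrier → Y.carrier → Z.carrier → W.carrier)
    (hf : ∃ n, ∀ m, n ≤ m → ∀ x y z, X.plot m x → Y.plot m y → Z.plot m z →
      W.plot m (fun i => f (x i) (y i) (z i))) :
    (arr X (arr Y (arr Z W))).carrier :=
  ⟨fun x => curry₂ (f x) (by
    obtain ⟨n, hn⟩ := hf
    obtain ⟨k, hk⟩ := X.const x
    exact ⟨max n k, fun m hm y z hy hz =>
      hn m (le_of_max_le_left hm) _ y z (X.mono (le_of_max_le_right hm) hk) hy hz⟩), by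
    obtain ⟨n, hn⟩ := hf
    exact ⟨n, fun m hm x hx m' hm' h hh y hy m'' hm'' h' hh' z hz =>
      hn m'' (hm.trans (hm'.trans hm'')) (fun i => x (h (h' i))) (fun i => y (h' i)) z
        (X.reparam (x := fun i => x (h i)) (X.mono hm'' (X.reparam (X.mono hm' hx) hh)) hh')
        (Y.reparam (Y.mono hm'' hy) hh') hz⟩⟩

/-- A sequence of functions is a plot if and only if it is of the given level as a function of
two variables. -/
theorem plot_arr_nat_iff {n : ℕ} {F : ℕ → (arr (nat 𝒜) (nat 𝒜)).carrier} :
    (arr (nat 𝒜) (nat 𝒜)).plot n F ↔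
      (fun i : ℕ => (F i.unpair.1).1 i.unpair.2) ∈ 𝒜.level n := by
  constructor
  · intro h
    exact h n le_rfl _ (𝒜.closed n).left _ (𝒜.closed n).right
  · intro h m hm g hg x hx
    exact (𝒜.closed m).uncurried (p := fun i => (F i).1) (𝒜.mono hm h) hg hx

/-- The points of `ℕ → ℕ` are the functions that occur in the chain. -/
theorem mem_level_of_arr_nat (F : (arr (nat 𝒜) (nat 𝒜)).carrier) :
    ∃ n, (F.1 : ℕ → ℕ) ∈ 𝒜.level n := by
  obtain ⟨n, hn⟩ := F.2
  exact ⟨n, hn n le_rfl _ (𝒜.closed n).id⟩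

/-- A function of the chain, as a point of `ℕ → ℕ`. -/
def ofLevel {n : ℕ} {f : ℕ → ℕ} (hf : f ∈ 𝒜.level n) : (arr (nat 𝒜) (nat 𝒜)).carrier :=
  ⟨f, n, fun m hm x hx => (𝒜.closed m).comp f (𝒜.mono hm hf) x hx⟩

theorem plot_natRec {m : ℕ} {F : ℕ → (arr (nat 𝒜) (arr (nat 𝒜) (nat 𝒜))).carrier}
    {a b : ℕ → ℕ} (hF : (arr (nat 𝒜) (arr (nat 𝒜) (nat 𝒜))).plot m F)
    (ha : a ∈ 𝒜.level m) (hb : b ∈ 𝒜.level m) :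
    (fun i => Nat.rec (motive := fun _ => ℕ) (a i)
      (fun k r => ((F i).1 k).1 r) (b i)) ∈ 𝒜.level m := by
  have h1 : (arr (nat 𝒜) (nat 𝒜)).plot m
      (fun i : ℕ => (F i.unpair.1).1 i.unpair.2.unpair.1) := hF m le_rfl _ (𝒜.closed m).left
    (fun i : ℕ => i.unpair.2.unpair.1) ((𝒜.closed m).comp _ (𝒜.closed m).left _ (𝒜.closed m).right)
  have h2 : (fun i : ℕ => ((F i.unpair.1).1 i.unpair.2.unpair.1).1 i.unpair.2.unpair.2) ∈
      𝒜.level m := plot_app (X := nat 𝒜) (Y := nat 𝒜) h1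
    (x := fun i : ℕ => i.unpair.2.unpair.2) ((𝒜.closed m).comp _ (𝒜.closed m).right _ (𝒜.closed m).right)
  simpa using (𝒜.closed m).natRec h2 ha hb

end Space

/-! ### The interpretation of the language -/

open Space

/-- The space that interprets a finite type. -/
def Ty.space (𝒜 : Chain) : Ty → Space 𝒜
  | Ty.zero => Space.nat 𝒜
  | Ty.arr σ τ => Space.arr (σ.space 𝒜) (τ.space 𝒜)

/-- The set that interprets a finite type. -/
abbrev Val (𝒜 : Chain) (σ : Ty) : Type := (σ.space 𝒜).carrier

variable {𝒜 : Chain}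

/-- Application of a functional to an argument. -/
def Val.app {σ τ : Ty} (F : Val 𝒜 (σ ⇒ τ)) (x : Val 𝒜 σ) : Val 𝒜 τ :=
  (show (Space.arr (σ.space 𝒜) (τ.space 𝒜)).carrier from F).1 x

theorem Val.ext {σ τ : Ty} {F G : Val 𝒜 (σ ⇒ τ)} (h : ∀ x, F.app x = G.app x) : F = G :=
  Subtype.ext (funext h)

/-- The natural number that is a given value of type `0`. -/
def Val.toNat (x : Val 𝒜 N) : ℕ := x

/-- A natural number, as a value of type `0`. -/
def Val.ofNat (n : ℕ) : Val 𝒜 N := n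

@[simp] theorem Val.toNat_ofNat (n : ℕ) : (Val.ofNat n : Val 𝒜 N).toNat = n := rfl

/-- The function on `ℕ` that is a given value of type `1`. -/
def Val.toFun (f : Val 𝒜 N1) : ℕ → ℕ := fun n => (f.app (Val.ofNat n)).toNat

/-- The recursor at type `0`. The recursors at other types have no laws, and are interpreted by
the projection to the second argument. -/
def Val.recr (𝒜 : Chain) : (σ : Ty) → Val 𝒜 ((N ⇒ σ ⇒ σ) ⇒ σ ⇒ N ⇒ σ)
  | Ty.zero => curry₃ (X := Ty.space 𝒜 (N ⇒ N ⇒ N)) (Y := Space.nat 𝒜) (Z := Space.nat 𝒜)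
      (W := Space.nat 𝒜)
      (fun F a b => Nat.rec (motive := fun _ => ℕ) a (fun k r => Val.app (Val.app F k) r) b)
      ⟨0, fun _ _ _ _ _ hF ha hb => plot_natRec hF ha hb⟩
  | Ty.arr σ τ => curry₃ (X := Ty.space 𝒜 (N ⇒ (σ ⇒ τ) ⇒ (σ ⇒ τ)))
      (Y := Ty.space 𝒜 (σ ⇒ τ)) (Z := Space.nat 𝒜) (W := Ty.space 𝒜 (σ ⇒ τ))
      (fun _ a _ => a) ⟨0, fun _ _ _ _ _ _ ha _ => ha⟩

/-- The values of the constants. -/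
def Const.val (𝒜 : Chain) : {σ : Ty} → Const σ → Val 𝒜 σ
  | _, .zero => (0 : ℕ)
  | _, .one => (1 : ℕ)
  | _, .add => curry₂ (X := Space.nat 𝒜) (Y := Space.nat 𝒜) (Z := Space.nat 𝒜)
      (fun a b : ℕ => a + b) ⟨0, fun m _ _ _ hx hy => (𝒜.closed m).comp₂ Primrec.nat_add hx hy⟩
  | _, .mul => curry₂ (X := Space.nat 𝒜) (Y := Space.nat 𝒜) (Z := Space.nat 𝒜)
      (fun a b : ℕ => a * b) ⟨0, fun m _ _ _ hx hy => (𝒜.closed m).comp₂ Primrec.nat_mul hx hy⟩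
  | _, .pi σ τ => curry₂ (X := σ.space 𝒜) (Y := τ.space 𝒜) (Z := σ.space 𝒜)
      (fun a _ => a) ⟨0, fun _ _ _ _ hx _ => hx⟩
  | _, .sigma ρ σ τ => curry₃ (X := Ty.space 𝒜 (ρ ⇒ σ ⇒ τ)) (Y := Ty.space 𝒜 (ρ ⇒ σ))
      (Z := ρ.space 𝒜) (W := τ.space 𝒜)
      (fun F G x => Val.app (Val.app F x) (Val.app G x))
      ⟨0, fun _ _ _ _ _ hF hG hx => plot_app (plot_app hF hx) (plot_app hG hx)⟩
  | _, .recr σ => Val.recr 𝒜 σ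

/-- An assignment of values to the variables of a context. -/
abbrev Env (𝒜 : Chain) (Γ : List Ty) : Type := ∀ σ : Ty, Var Γ σ → Val 𝒜 σ

/-- The extension of an assignment by a value of the most recent variable. -/
def Env.cons {Γ : List Ty} {σ : Ty} (a : Val 𝒜 σ) (ρ : Env 𝒜 Γ) : Env 𝒜 (σ :: Γ)
  | _, Var.z => a
  | _, Var.s x => ρ _ x

def Env.nil : Env 𝒜 [] := fun _ x => nomatch x

theorem Env.eq_nil (ρ : Env 𝒜 []) : ρ = Env.nil := by
  funext σ x; exact nomatch x

theorem Env.eq_cons {Γ : List Ty} {σ : Ty} (ρ : Env 𝒜 (σ :: Γ)) :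
    ρ = Env.cons (ρ σ Var.z) (fun _ x => ρ _ (Var.s x)) := by
  funext τ x; cases x <;> rfl

/-- The value of a term. -/
def Term.eval {Γ : List Ty} (ρ : Env 𝒜 Γ) : {σ : Ty} → Term Γ σ → Val 𝒜 σ
  | _, .var x => ρ _ x
  | _, .const c => c.val 𝒜
  | _, .app s t => (s.eval ρ).app (t.eval ρ)

/-- Truth in the model. -/
def Formula.Sat : {Γ : List Ty} → Env 𝒜 Γ → Formula Γ → Prop
  | _, _, .falsum => False
  | _, ρ, .eq s t => (s.eval ρ).toNat = (t.eval ρ).toNat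
  | _, ρ, .lt s t => (s.eval ρ).toNat < (t.eval ρ).toNat
  | _, ρ, .imp φ ψ => φ.Sat ρ → ψ.Sat ρ
  | _, ρ, .all σ φ => ∀ a : Val 𝒜 σ, φ.Sat (ρ.cons a)

section
variable {Γ Δ : List Ty}

theorem Term.eval_subst (f : Subst Γ Δ) (ρ : Env 𝒜 Δ) {σ : Ty} (t : Term Γ σ) :
    (t.subst f).eval ρ = t.eval (fun _ x => (f _ x).eval ρ) := by
  induction t with
  | var x => rfl
  | const c => rfl
  | app s t hs ht => simp only [Term.subst, Term.eval, hs, ht]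

@[simp] theorem Term.eval_wk {σ τ : Ty} (ρ : Env 𝒜 Γ) (a : Val 𝒜 τ) (t : Term Γ σ) :
    (t.wk (τ := τ)).eval (ρ.cons a) = t.eval ρ := by
  rw [Term.wk, Term.eval_subst]; rfl

theorem Subst.eval_lift (f : Subst Γ Δ) (ρ : Env 𝒜 Δ) {σ : Ty} (a : Val 𝒜 σ) :
    (fun _ x => (f.lift σ _ x).eval (ρ.cons a)) =
      Env.cons a (fun _ x => (f _ x).eval ρ) := by
  funext τ x
  cases x with
  | z => rfl
  | s x => simp [Subst.lift, Env.cons]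

theorem Formula.sat_subst (φ : Formula Γ) : ∀ {Δ : List Ty} (f : Subst Γ Δ) (ρ : Env 𝒜 Δ),
    (φ.subst f).Sat ρ ↔ φ.Sat (fun _ x => (f _ x).eval ρ) := by
  induction φ with
  | falsum => intros; rfl
  | eq s t => intros; simp only [Formula.subst, Formula.Sat, Term.eval_subst]
  | lt s t => intros; simp only [Formula.subst, Formula.Sat, Term.eval_subst]
  | imp φ ψ h1 h2 => intros; simp only [Formula.subst, Formula.Sat, h1, h2]
  | all σ φ h => intros; simp only [Formula.subst, Formula.Sat, h, Subst.eval_lift]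

theorem Formula.sat_wk {τ : Ty} (φ : Formula Γ) (ρ : Env 𝒜 Γ) (a : Val 𝒜 τ) :
    (φ.wk (τ := τ)).Sat (ρ.cons a) ↔ φ.Sat ρ := by
  rw [Formula.wk, Formula.sat_subst]; rfl

theorem Formula.sat_inst {τ : Ty} (φ : Formula (τ :: Γ)) (t : Term Γ τ) (ρ : Env 𝒜 Γ) :
    (φ.inst t).Sat ρ ↔ φ.Sat (ρ.cons (t.eval ρ)) := by
  rw [Formula.inst, Formula.sat_subst]
  have : (fun σ x => (Subst.single t σ x).eval ρ) = Env.cons (t.eval ρ) ρ := by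
    funext σ x; cases x <;> rfl
  rw [this]

theorem Formula.sat_ofSentence (φ : Sentence) (ρ : Env 𝒜 Γ) :
    (φ.ofSentence (Γ := Γ)).Sat ρ ↔ φ.Sat (𝒜 := 𝒜) Env.nil := by
  rw [Formula.ofSentence, Formula.sat_subst, Env.eq_nil (fun _ _ => _)]

theorem Formula.sat_close : ∀ {Γ : List Ty} (φ : Formula Γ),
    φ.close.Sat (𝒜 := 𝒜) Env.nil ↔ ∀ ρ : Env 𝒜 Γ, φ.Sat ρ
  | [], φ => ⟨fun h ρ => ρ.eq_nil ▸ h, fun h => h _⟩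
  | σ :: Γ, φ => by
    rw [Formula.close, Formula.sat_close]
    exact ⟨fun h ρ => ρ.eq_cons ▸ h _ _, fun h ρ a => h _⟩

variable (ρ : Env 𝒜 Γ)

@[simp] theorem Formula.sat_neg (φ : Formula Γ) : φ.neg.Sat ρ ↔ ¬ φ.Sat ρ := Iff.rfl

@[simp] theorem Formula.sat_imp (φ ψ : Formula Γ) :
    (φ.imp ψ).Sat ρ ↔ (φ.Sat ρ → ψ.Sat ρ) := Iff.rfl

@[simp] theorem Formula.sat_all {σ : Ty} (φ : Formula (σ :: Γ)) :
    (Formula.all σ φ).Sat ρ ↔ ∀ a : Val 𝒜 σ, φ.Sat (ρ.cons a) := Iff.rfl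

@[simp] theorem Formula.sat_and (φ ψ : Formula Γ) : (φ.and ψ).Sat ρ ↔ φ.Sat ρ ∧ ψ.Sat ρ := by
  simp only [Formula.and, Formula.sat_neg, Formula.sat_imp]; tauto

@[simp] theorem Formula.sat_or (φ ψ : Formula Γ) : (φ.or ψ).Sat ρ ↔ φ.Sat ρ ∨ ψ.Sat ρ := by
  simp only [Formula.or, Formula.sat_neg, Formula.sat_imp]; tauto

@[simp] theorem Formula.sat_iff (φ ψ : Formula Γ) :
    (φ.iff ψ).Sat ρ ↔ (φ.Sat ρ ↔ ψ.Sat ρ) := by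
  simp only [Formula.iff, Formula.sat_and, Formula.sat_imp]; tauto

@[simp] theorem Formula.sat_ex {σ : Ty} (φ : Formula (σ :: Γ)) :
    (Formula.ex σ φ).Sat ρ ↔ ∃ a : Val 𝒜 σ, φ.Sat (ρ.cons a) := by
  simp [Formula.ex]

@[simp] theorem Formula.sat_eq (s t : Term Γ N) :
    (Formula.eq s t).Sat ρ ↔ (s.eval ρ).toNat = (t.eval ρ).toNat := Iff.rfl

@[simp] theorem Formula.sat_lt (s t : Term Γ N) :
    (Formula.lt s t).Sat ρ ↔ (s.eval ρ).toNat < (t.eval ρ).toNat := Iff.rfl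

@[simp] theorem Formula.sat_le (s t : Term Γ N) :
    (Formula.le s t).Sat ρ ↔ (s.eval ρ).toNat ≤ (t.eval ρ).toNat := by
  simp [Formula.le, Nat.le_iff_lt_or_eq]

/-- The model is extensional: the defined equality of each type is equality of values. -/
@[simp] theorem Formula.sat_eqT : ∀ (τ : Ty) {Γ : List Ty} (ρ : Env 𝒜 Γ) (s t : Term Γ τ),
    (Formula.eqT τ s t).Sat ρ ↔ s.eval ρ = t.eval ρ
  | Ty.zero, _, _, _, _ => Iff.rfl
  | Ty.arr σ τ, _, ρ, s, t => by
    simp only [Formula.eqT, Formula.sat_all, Formula.sat_eqT τ, Term.eval, Term.eval_wk]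
    exact ⟨Val.ext, fun h a => by rw [h]⟩

/-- Soundness of the calculus. -/
theorem Derives.sound {T : Set Sentence} (hT : ∀ φ ∈ T, φ.Sat (𝒜 := 𝒜) Env.nil)
    {Γ : List Ty} {Δ : List (Formula Γ)} {φ : Formula Γ} (h : Derives T Δ φ) :
    ∀ ρ : Env 𝒜 Γ, (∀ ψ ∈ Δ, ψ.Sat ρ) → φ.Sat ρ := by
  induction h with
  | thy h => intro ρ _; exact (Formula.sat_ofSentence _ _).2 (hT _ h)
  | hyp h => intro ρ hΔ; exact hΔ _ h
  | impI _ ih =>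
    intro ρ hΔ hφ
    exact ih ρ (by simpa using ⟨hφ, hΔ⟩)
  | impE _ _ ih1 ih2 => intro ρ hΔ; exact ih1 ρ hΔ (ih2 ρ hΔ)
  | raa _ ih =>
    intro ρ hΔ
    by_contra hφ
    exact ih ρ (by simpa using ⟨hφ, hΔ⟩)
  | allI _ ih =>
    intro ρ hΔ a
    refine ih _ fun ψ hψ => ?_
    obtain ⟨χ, hχ, rfl⟩ := List.mem_map.1 hψ
    exact (Formula.sat_wk χ ρ a).2 (hΔ χ hχ)
  | allE t _ ih => intro ρ hΔ; exact (Formula.sat_inst _ _ _).2 (ih ρ hΔ _)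
  | eqRefl t => intros; rfl
  | eqSubst φ _ _ ih1 ih2 =>
    intro ρ hΔ
    have h1 := ih1 ρ hΔ
    have h2 := (Formula.sat_inst _ _ _).1 (ih2 ρ hΔ)
    rw [Formula.sat_inst]
    exact (congrArg (fun a : Val 𝒜 N => φ.Sat (ρ.cons a)) h1).mp h2

end

/-! ### Values of terms -/

theorem Val.toNat_app (f : Val 𝒜 N1) (x : Val 𝒜 N) : (f.app x).toNat = f.toFun x.toNat := rfl

theorem Val.exists_nat {p : Val 𝒜 N → Prop} : (∃ x, p x) ↔ ∃ n : ℕ, p (Val.ofNat n) := Iff.rfl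

theorem Val.forall_nat {p : Val 𝒜 N → Prop} : (∀ x, p x) ↔ ∀ n : ℕ, p (Val.ofNat n) := Iff.rfl

theorem Val.toFun_mem (f : Val 𝒜 N1) : ∃ n, f.toFun ∈ 𝒜.level n := mem_level_of_arr_nat f

/-- A function of the chain, as a value of type `1`. -/
noncomputable def Val.ofFun (f : ℕ → ℕ) (hf : ∃ n, f ∈ 𝒜.level n) : Val 𝒜 N1 := ofLevel hf.choose_spec

section
variable {Γ : List Ty} (ρ : Env 𝒜 Γ)

@[simp] theorem Env.cons_z {σ : Ty} (a : Val 𝒜 σ) : ρ.cons a σ Var.z = a := rfl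

@[simp] theorem Env.cons_s {σ τ : Ty} (a : Val 𝒜 σ) (x : Var Γ τ) :
    ρ.cons a τ (Var.s x) = ρ τ x := rfl

@[simp] theorem Term.eval_var {σ : Ty} (x : Var Γ σ) : (Term.var x).eval ρ = ρ σ x := rfl

@[simp] theorem Term.eval_app {σ τ : Ty} (s : Term Γ (σ ⇒ τ)) (t : Term Γ σ) :
    (s.app t).eval ρ = (s.eval ρ).app (t.eval ρ) := rfl

@[simp] theorem Term.toNat_zero : ((0 : Term Γ N).eval ρ).toNat = 0 := rfl

@[simp] theorem Term.toNat_one : ((1 : Term Γ N).eval ρ).toNat = 1 := rfl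

@[simp] theorem Term.toNat_add (s t : Term Γ N) :
    ((s + t).eval ρ).toNat = (s.eval ρ).toNat + (t.eval ρ).toNat := rfl

@[simp] theorem Term.toNat_mul (s t : Term Γ N) :
    ((s * t).eval ρ).toNat = (s.eval ρ).toNat * (t.eval ρ).toNat := rfl

@[simp] theorem Term.app_lam {σ : Ty} : ∀ {τ : Ty} (t : Term (σ :: Γ) τ) (a : Val 𝒜 σ),
    ((lam t).eval ρ).app a = t.eval (ρ.cons a)
  | _, .var .z, _ => rfl
  | _, .var (.s _), _ => rfl
  | _, .const _, _ => rfl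
  | _, .app s t, a => by
    show (((lam s).eval ρ).app a).app (((lam t).eval ρ).app a) = _
    rw [Term.app_lam s a, Term.app_lam t a]; rfl

theorem Term.toNat_recN (f : Term Γ (N ⇒ N ⇒ N)) (m n : Term Γ N) :
    ((recN f m n).eval ρ).toNat = Nat.rec (motive := fun _ => ℕ) (m.eval ρ).toNat
      (fun k r => (((f.eval ρ).app (Val.ofNat k)).app (Val.ofNat r)).toNat) (n.eval ρ).toNat := rfl

@[simp] theorem Term.toNat_recN_lam (t : Term (N :: N :: Γ) N) (m n : Term Γ N) :
    ((recN (lam (lam t)) m n).eval ρ).toNat = Nat.rec (motive := fun _ => ℕ) (m.eval ρ).toNat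
      (fun k r => (t.eval ((ρ.cons (Val.ofNat k)).cons (Val.ofNat r))).toNat)
      (n.eval ρ).toNat := by
  simp [Term.toNat_recN]

/-! ### Truth of the axioms of the base theory -/

theorem sat_isArith {φ : Formula [N, N, N]} (h : IsArith φ) (ρ : Env 𝒜 [N, N, N]) : φ.Sat ρ := by
  cases h <;> simp [Val.exists_nat]
  case addAssoc => ring
  case addComm => ring
  case mulAssoc => ring
  case mulComm => ring
  case distrib => ring
  case ltTrans => exact fun h => h.trans
  case ltTotal => exact lt_trichotomy _ _
  case mulMono => exact fun h1 h2 => Nat.mul_lt_mul_of_pos_right h2 h1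
  case diff => exact fun h => ⟨_, Nat.add_sub_cancel' h.le⟩
  case discrete => exact fun h => h

theorem exists_const_plot_env : ∀ {Γ : List Ty} (ρ : Env 𝒜 Γ),
    ∃ n, ∀ (σ : Ty) (x : Var Γ σ), (σ.space 𝒜).plot n (fun _ => ρ σ x)
  | [], _ => ⟨0, fun _ x => nomatch x⟩
  | σ :: Γ, ρ => by
    obtain ⟨n, hn⟩ := exists_const_plot_env (fun τ (x : Var Γ τ) => ρ τ (Var.s x))
    obtain ⟨k, hk⟩ := (σ.space 𝒜).const (ρ σ Var.z)
    refine ⟨max n k, fun τ x => ?_⟩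
    cases x with
    | z => exact (σ.space 𝒜).mono (le_max_right _ _) hk
    | s x => exact (τ.space 𝒜).mono (le_max_left _ _) (hn τ x)

/-- Terms preserve plots, from a level on at which the constants of the term have plots. -/
theorem plot_eval {σ : Ty} (t : Term Γ σ) : ∃ n, ∀ m, n ≤ m → ∀ ρ : ℕ → Env 𝒜 Γ,
    (∀ (τ : Ty) (x : Var Γ τ), (τ.space 𝒜).plot m (fun i => ρ i τ x)) →
      (σ.space 𝒜).plot m (fun i => t.eval (ρ i)) := by
  induction t with
  | var x => exact ⟨0, fun m _ ρ h => h _ x⟩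
  | @const σ c =>
    obtain ⟨n, hn⟩ := (σ.space 𝒜).const (c.val 𝒜)
    exact ⟨n, fun m hm ρ _ => (σ.space 𝒜).mono hm hn⟩
  | app s t hs ht =>
    obtain ⟨n, hn⟩ := hs
    obtain ⟨k, hk⟩ := ht
    exact ⟨max n k, fun m hm ρ h => plot_app (hn m (le_of_max_le_left hm) ρ h)
      (hk m (le_of_max_le_right hm) ρ h)⟩

open Classical in
/-- The truth value of a quantifier-free formula is computable from its parameters. -/
theorem truth_mem_level (φ : Formula Γ) (hφ : φ.IsQF) : ∃ n, ∀ m, n ≤ m → ∀ ρ : ℕ → Env 𝒜 Γ,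
    (∀ (τ : Ty) (x : Var Γ τ), (τ.space 𝒜).plot m (fun i => ρ i τ x)) →
      (fun i => if φ.Sat (ρ i) then 0 else 1) ∈ 𝒜.level m := by
  induction φ with
  | falsum => exact ⟨0, fun m _ ρ _ => by simpa [Formula.Sat] using (𝒜.closed m).const 1⟩
  | eq s t =>
    obtain ⟨n, hn⟩ := plot_eval (𝒜 := 𝒜) s
    obtain ⟨k, hk⟩ := plot_eval (𝒜 := 𝒜) t
    refine ⟨max n k, fun m hm ρ h => ?_⟩
    have hp : Primrec₂ (fun a b : ℕ => if a = b then 0 else 1) :=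
      Primrec.ite Primrec.eq (Primrec.const 0) (Primrec.const 1)
    convert (𝒜.closed m).comp₂ hp (hn m (le_of_max_le_left hm) ρ h)
      (hk m (le_of_max_le_right hm) ρ h) using 3
    exact Iff.rfl
  | lt s t =>
    obtain ⟨n, hn⟩ := plot_eval (𝒜 := 𝒜) s
    obtain ⟨k, hk⟩ := plot_eval (𝒜 := 𝒜) t
    refine ⟨max n k, fun m hm ρ h => ?_⟩
    have hp : Primrec₂ (fun a b : ℕ => if a < b then 0 else 1) :=
      Primrec.ite Primrec.nat_lt (Primrec.const 0) (Primrec.const 1)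
    convert (𝒜.closed m).comp₂ hp (hn m (le_of_max_le_left hm) ρ h)
      (hk m (le_of_max_le_right hm) ρ h) using 3
    exact Iff.rfl
  | imp φ ψ h1 h2 =>
    obtain ⟨n, hn⟩ := h1 hφ.1
    obtain ⟨k, hk⟩ := h2 hφ.2
    refine ⟨max n k, fun m hm ρ h => ?_⟩
    have hp : Primrec₂ (fun a b : ℕ => (1 - a) * b) :=
      Primrec.nat_mul.comp (Primrec.nat_sub.comp (Primrec.const 1) Primrec.fst) Primrec.snd
    have := (𝒜.closed m).comp₂ hp (hn m (le_of_max_le_left hm) ρ h)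
      (hk m (le_of_max_le_right hm) ρ h)
    convert this using 2 with i
    by_cases h3 : φ.Sat (ρ i) <;> by_cases h4 : ψ.Sat (ρ i) <;> simp [h3, h4]
  | all => exact hφ.elim

theorem sat_choice10 (A : Formula (N :: N1 :: Γ)) (hA : A.IsQF) : (choice10 A).Sat ρ := by
  classical
  intro hex
  simp only [Formula.sat_all, Formula.sat_ex] at hex
  obtain ⟨n, hn⟩ := truth_mem_level (𝒜 := 𝒜) A hA
  obtain ⟨k, hk⟩ := exists_const_plot_env ρ
  -- The choice functional is computed by unbounded search, which keeps plots in their level.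
  let Y : Val 𝒜 N1 → ℕ := fun x => sInf {y | A.Sat ((ρ.cons x).cons (Val.ofNat y))}
  have hY : ∀ x, A.Sat ((ρ.cons x).cons (Val.ofNat (Y x))) := fun x =>
    Nat.sInf_mem (s := {y | A.Sat ((ρ.cons x).cons (Val.ofNat y))}) (hex x)
  have hplot : ∀ m, max n k ≤ m → ∀ x, (N1.space 𝒜).plot m x →
      (fun i => Y (x i)) ∈ 𝒜.level m := by
    intro m hm x hx
    have h1 := hn m (le_of_max_le_left hm)
      (fun j => (ρ.cons (x j.unpair.1)).cons (Val.ofNat j.unpair.2)) (by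
        intro τ v
        match v with
        | .z => exact (𝒜.closed m).right
        | .s .z => exact (N1.space 𝒜).reparam hx (𝒜.closed m).left
        | .s (.s v) => exact (τ.space 𝒜).mono (le_of_max_le_right hm) (hk τ v))
    have h2 := (𝒜.closed m).search _ h1
    simpa [Y] using h2
  rw [Formula.sat_ex]
  refine ⟨(⟨Y, max n k, hplot⟩ : (arr (N1.space 𝒜) (Space.nat 𝒜)).carrier), fun x => ?_⟩
  rw [Formula.sat_subst]
  convert hY x using 1
  funext τ v
  match v with
  | .z => rfl
  | .s .z => rfl
  | .s (.s v) => rfl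

theorem sat_RCA0ω {φ : Sentence} (h : RCA0ω φ) : φ.Sat (𝒜 := 𝒜) Env.nil := by
  cases h with
  | arith h => exact (Formula.sat_close _).2 (sat_isArith h)
  | pi σ τ => rw [Formula.sat_close]; intro ρ; rw [Formula.sat_eqT]; rfl
  | sigma ρ σ τ => rw [Formula.sat_close]; intro ρ; rw [Formula.sat_eqT]; rfl
  | recZero => rw [Formula.sat_close]; intro ρ; rfl
  | recSucc => rw [Formula.sat_close]; intro ρ; rfl
  | ext ρ τ =>
    rw [Formula.sat_close]
    intro ρ h
    rw [Formula.sat_eqT] at h ⊢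
    simp only [Term.eval_app, h]
  | ind A =>
    rw [Formula.sat_close]
    intro ρ h0 hs a
    rw [Formula.sat_inst] at h0
    have hs' : ∀ n : ℕ, A.Sat (ρ.cons (Val.ofNat n)) → A.Sat (ρ.cons (Val.ofNat (n + 1))) := by
      intro n hn
      have := hs (Val.ofNat n) hn
      rw [Formula.sat_subst] at this
      convert this using 1
      funext σ x
      cases x <;> rfl
    exact Nat.rec (motive := fun n => A.Sat (ρ.cons (Val.ofNat n))) h0 hs' a.toNat
  | choice A hA => exact (Formula.sat_close _).2 fun ρ => sat_choice10 ρ A hA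

/-! ### Coding of pairs and sequences -/

/-- The `n`-th triangular number. -/
def triangle (n : ℕ) : ℕ := n * (n + 1) / 2

theorem triangle_succ (n : ℕ) : triangle (n + 1) = triangle n + (n + 1) := by
  unfold triangle
  rw [show (n + 1) * (n + 1 + 1) = n * (n + 1) + (n + 1) * 2 by ring,
    Nat.add_mul_div_right _ _ two_pos]

@[simp] theorem Term.toNat_pow2 (n : Term Γ N) :
    ((pow2 n).eval ρ).toNat = 2 ^ (n.eval ρ).toNat := by
  rw [pow2, Term.toNat_recN_lam]
  simp
  induction (n.eval ρ).toNat with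
  | zero => rfl
  | succ k ih => simp only [ih, pow_succ, mul_two]

@[simp] theorem Term.toNat_pred (n : Term Γ N) :
    ((pred n).eval ρ).toNat = (n.eval ρ).toNat - 1 := by
  rw [pred, Term.toNat_recN_lam]
  cases (n.eval ρ).toNat <;> simp

@[simp] theorem Term.toNat_monus (m n : Term Γ N) :
    ((monus m n).eval ρ).toNat = (m.eval ρ).toNat - (n.eval ρ).toNat := by
  rw [monus, Term.toNat_recN_lam]
  simp
  induction (n.eval ρ).toNat with
  | zero => rfl
  | succ k ih => simp only [ih, Nat.sub_sub]

@[simp] theorem Term.toNat_tri (n : Term Γ N) :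
    ((tri n).eval ρ).toNat = triangle (n.eval ρ).toNat := by
  rw [tri, Term.toNat_recN_lam]
  simp
  induction (n.eval ρ).toNat with
  | zero => rfl
  | succ k ih => simp only [ih, triangle_succ]

/-- The Cantor pairing. -/
def cantorPair (m n : ℕ) : ℕ := triangle (m + n) + m

@[simp] theorem Term.toNat_pair (m n : Term Γ N) :
    ((pair m n).eval ρ).toNat = cantorPair (m.eval ρ).toNat (n.eval ρ).toNat := by
  simp [pair, cantorPair]

/-- The sum of the components of a pair, by the recursion of `HOA.pairSum`. -/
def cantorSum (c : ℕ) : ℕ := Nat.rec (motive := fun _ => ℕ) 0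
  (fun k r => r + (1 - (triangle (r + 1) - (k + 1)))) c

@[simp] theorem Term.toNat_pairSum (c : Term Γ N) :
    ((pairSum c).eval ρ).toNat = cantorSum (c.eval ρ).toNat := by
  simp [pairSum, cantorSum]

/-- The recursion finds the largest `w` with `triangle w ≤ c`. -/
theorem cantorSum_spec (c : ℕ) : triangle (cantorSum c) ≤ c ∧ c < triangle (cantorSum c + 1) := by
  induction c with
  | zero => exact ⟨le_rfl, by decide⟩
  | succ c ih =>
    have h : cantorSum (c + 1) =
        cantorSum c + (1 - (triangle (cantorSum c + 1) - (c + 1))) := rfl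
    by_cases hc : triangle (cantorSum c + 1) ≤ c + 1
    · rw [Nat.sub_eq_zero_of_le hc] at h
      rw [h, triangle_succ (cantorSum c + (1 - 0))]
      exact ⟨hc, by have := ih.2; simp only [Nat.sub_zero]; omega⟩
    · have h1 : 1 - (triangle (cantorSum c + 1) - (c + 1)) = 0 := by omega
      rw [h1] at h
      rw [h]
      exact ⟨by have := ih.1; simp only [Nat.add_zero]; omega, by
        simp only [Nat.add_zero]; omega⟩

theorem triangle_mono : Monotone triangle :=
  monotone_nat_of_le_succ fun n => by rw [triangle_succ]; omega

theorem cantorSum_cantorPair (m n : ℕ) : cantorSum (cantorPair m n) = m + n := by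
  have h := cantorSum_spec (cantorPair m n)
  have h1 : triangle (m + n) ≤ cantorPair m n := Nat.le_add_right _ _
  have h2 : cantorPair m n < triangle (m + n + 1) := by
    rw [triangle_succ]; unfold cantorPair; omega
  by_contra hne
  rcases lt_or_gt_of_ne hne with hlt | hlt
  · have := triangle_mono (Nat.succ_le_of_lt hlt)
    exact absurd h.2 (by simp only [Nat.succ_eq_add_one] at this; omega)
  · have := triangle_mono (Nat.succ_le_of_lt hlt)
    exact absurd h.1 (by simp only [Nat.succ_eq_add_one] at this; omega)

@[simp] theorem Term.toNat_parity (n : Term Γ N) :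
    ((parity n).eval ρ).toNat = (n.eval ρ).toNat % 2 := by
  rw [parity, Term.toNat_recN_lam]
  simp
  induction (n.eval ρ).toNat with
  | zero => rfl
  | succ k ih => simp only [ih]; omega

@[simp] theorem Term.toNat_half (n : Term Γ N) :
    ((half n).eval ρ).toNat = (n.eval ρ).toNat / 2 := by
  rw [half, Term.toNat_recN_lam]
  simp
  induction (n.eval ρ).toNat with
  | zero => rfl
  | succ k ih => simp only [ih]; omega

/-- The code of an initial segment of a function. -/
def segCode (g : ℕ → ℕ) (n : ℕ) : ℕ :=
  Nat.rec (motive := fun _ => ℕ) 0 (fun k c => cantorPair c (g k) + 1) n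

@[simp] theorem Term.toNat_bar (g : Term Γ N1) (n : Term Γ N) :
    ((bar g n).eval ρ).toNat = segCode (g.eval ρ).toFun (n.eval ρ).toNat := by
  simp [bar, segCode, Val.toNat_app]

/-- The code of the initial segments of the functions of a list. -/
def segCodes (n : ℕ) : List (ℕ → ℕ) → ℕ
  | [] => n
  | [g] => segCode g n
  | g :: h :: gs => cantorPair (segCode g n) (segCodes n (h :: gs))

theorem Term.toNat_barTuple (n : Term Γ N) : ∀ gs : List (Term Γ N1),
    ((barTuple n gs).eval ρ).toNat =
      segCodes (n.eval ρ).toNat (gs.map fun g => (g.eval ρ).toFun)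
  | [] => rfl
  | [g] => by simp [barTuple, segCodes]
  | g :: h :: gs => by
    rw [barTuple, Term.toNat_pair, Term.toNat_barTuple n (h :: gs)]
    simp [segCodes]

/-! ### The functionals `S_k` -/

/-- The truth of the formula `HOA.kleene` when the function quantifiers range over the set `s`. -/
def kleeneTrue (s : Set (ℕ → ℕ)) : ℕ → Bool → (ℕ → ℕ) → List (ℕ → ℕ) → Prop
  | 0, true, f, gs => ∃ n, f (segCodes n gs) = 0
  | 0, false, f, gs => ∀ n, f (segCodes n gs) = 0
  | k + 1, true, f, gs => ∃ g ∈ s, kleeneTrue s k false f (gs ++ [g])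
  | k + 1, false, f, gs => ∀ g ∈ s, kleeneTrue s k true f (gs ++ [g])

theorem sat_kleene : ∀ (k : ℕ) (e : Bool) {Γ : List Ty} (ρ : Env 𝒜 Γ) (f : Term Γ N1)
    (gs : List (Term Γ N1)), (kleene k e f gs).Sat ρ ↔
      kleeneTrue {g | ∃ n, g ∈ 𝒜.level n} k e (f.eval ρ).toFun
        (gs.map fun g => (g.eval ρ).toFun)
  | 0, true, _, ρ, f, gs => by
    simp [kleene, kleeneTrue, Val.toNat_app, Term.toNat_barTuple, Val.exists_nat,
      Function.comp_def]
  | 0, false, _, ρ, f, gs => by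
    simp [kleene, kleeneTrue, Val.toNat_app, Term.toNat_barTuple, Val.forall_nat,
      Function.comp_def]
  | k + 1, true, _, ρ, f, gs => by
    simp only [kleene, kleeneTrue, Formula.sat_ex, sat_kleene k]
    simp only [List.map_append, List.map_map, Function.comp_def, Term.eval_wk, List.map_cons,
      List.map_nil, Term.eval_var, Env.cons_z]
    exact ⟨fun ⟨g, hg⟩ => ⟨g.toFun, g.toFun_mem, hg⟩, fun ⟨g, hg, h⟩ => ⟨Val.ofFun g hg, h⟩⟩
  | k + 1, false, _, ρ, f, gs => by
    simp only [kleene, kleeneTrue, Formula.sat_all, sat_kleene k]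
    simp only [List.map_append, List.map_map, Function.comp_def, Term.eval_wk, List.map_cons,
      List.map_nil, Term.eval_var, Env.cons_z]
    exact ⟨fun h g hg => h (Val.ofFun g hg), fun h g => h g.toFun g.toFun_mem⟩

open Classical in
/-- The sequence of the values of `S_k`, with quantifiers over the set `s`, at the functions
coded by `f`. -/
noncomputable def jump (s : Set (ℕ → ℕ)) (k : ℕ) (f : ℕ → ℕ) : ℕ → ℕ := fun i =>
  if kleeneTrue s k true (fun j => f (Nat.pair i j)) [] then 0 else 1

/-- The model has `S_k` if the jumps relative to the functions of the model preserve the levels. -/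
theorem sat_existsS (k : ℕ)
    (hS : ∀ m, ∀ f ∈ 𝒜.level m, jump {g | ∃ n, g ∈ 𝒜.level n} k f ∈ 𝒜.level m) :
    (existsS k).Sat (𝒜 := 𝒜) Env.nil := by
  classical
  let S : Val 𝒜 N1 → ℕ := fun f =>
    if kleeneTrue {g | ∃ n, g ∈ 𝒜.level n} k true f.toFun [] then 0 else 1
  have hplot : ∀ m, 0 ≤ m → ∀ x, (N1.space 𝒜).plot m x → (fun i => S (x i)) ∈ 𝒜.level m := by
    intro m _ x hx
    have h := hS m _ (plot_arr_nat_iff.1 hx)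
    unfold jump at h
    simp only [Nat.unpair_pair] at h
    exact h
  rw [existsS, Formula.sat_ex]
  refine ⟨(⟨S, 0, hplot⟩ : (arr (N1.space 𝒜) (Space.nat 𝒜)).carrier), ?_⟩
  rw [Formula.sat_and]
  constructor
  · intro f
    rw [Formula.sat_le]
    show S f ≤ 1
    dsimp only [S]
    split <;> simp
  · intro f
    rw [Formula.sat_iff, sigmaForm, sat_kleene, Formula.sat_eq]
    show _ ↔ S f = 0
    simp [S]

end

/-! ### Real numbers and their codes -/

/-- The first component of a pair. -/
def cantorFst (c : ℕ) : ℕ := c - triangle (cantorSum c)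

/-- The second component of a pair. -/
def cantorSnd (c : ℕ) : ℕ := cantorSum c - cantorFst c

theorem cantorFst_cantorPair (m n : ℕ) : cantorFst (cantorPair m n) = m := by
  rw [cantorFst, cantorSum_cantorPair, cantorPair, Nat.add_sub_cancel_left]

theorem cantorSnd_cantorPair (m n : ℕ) : cantorSnd (cantorPair m n) = n := by
  rw [cantorSnd, cantorSum_cantorPair, cantorFst_cantorPair, Nat.add_sub_cancel_left]

/-- The rational number with a given code. -/
def ratOf (c : ℕ) : ℚ :=
  ((((1 - cantorFst c % 2) * (cantorFst c / 2) : ℕ) : ℚ) -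
    ((cantorFst c % 2 * (cantorFst c / 2 + 1) : ℕ) : ℚ)) / ((cantorSnd c + 1 : ℕ) : ℚ)

theorem ratOf_surjective : Function.Surjective ratOf := by
  intro q
  have hq : q = (q.num : ℚ) / (q.den : ℚ) := (Rat.num_div_den q).symm
  obtain ⟨d, hd⟩ : ∃ d, q.den = d + 1 := ⟨q.den - 1, by have := q.den_pos; omega⟩
  rcases Int.eq_nat_or_neg q.num with ⟨a, ha | ha⟩
  · refine ⟨cantorPair (2 * a) d, ?_⟩
    rw [ratOf, cantorFst_cantorPair, cantorSnd_cantorPair]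
    conv_rhs => rw [hq, ha, hd]
    simp
  · rcases a with _ | a
    · refine ⟨cantorPair 0 d, ?_⟩
      rw [ratOf, cantorFst_cantorPair, cantorSnd_cantorPair]
      conv_rhs => rw [hq, ha, hd]
      simp
    · refine ⟨cantorPair (2 * a + 1) d, ?_⟩
      rw [ratOf, cantorFst_cantorPair, cantorSnd_cantorPair]
      conv_rhs => rw [hq, ha, hd]
      have h1 : (2 * a + 1) % 2 = 1 := by omega
      have h2 : (2 * a + 1) / 2 = a := by omega
      rw [h1, h2]
      push_cast
      simp

/-- The sequence of rationals coded by `x` converges fast. -/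
def IsFast (x : ℕ → ℕ) : Prop :=
  ∀ n i, |ratOf (x n) - ratOf (x (n + i))| < (1 / 2) ^ n

/-- The sequence of rationals coded by `x` converges to `v` with the rate of a code of `v`. -/
def HasValue (x : ℕ → ℕ) (v : ℝ) : Prop := ∀ n, |(ratOf (x n) : ℝ) - v| ≤ (1 / 2) ^ n

theorem eventually_two_mul_half_pow_lt {ε : ℝ} (hε : 0 < ε) (C : ℝ) :
    ∃ n : ℕ, C * (1 / 2) ^ n < ε := by
  have h : Filter.Tendsto (fun n : ℕ => C * (1 / 2 : ℝ) ^ n) Filter.atTop (nhds (C * 0)) :=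
    (tendsto_pow_atTop_nhds_zero_of_lt_one (by norm_num) (by norm_num)).const_mul C
  rw [mul_zero] at h
  exact (h.eventually (gt_mem_nhds hε)).exists

theorem HasValue.unique {x : ℕ → ℕ} {v w : ℝ} (hv : HasValue x v) (hw : HasValue x w) : v = w := by
  by_contra hne
  obtain ⟨n, hn⟩ := eventually_two_mul_half_pow_lt (abs_pos.2 (sub_ne_zero.2 hne)) 2
  have h1 := abs_le.1 (hv n)
  have h2 := abs_le.1 (hw n)
  have : |v - w| ≤ 2 * (1 / 2) ^ n := abs_le.2 ⟨by linarith, by linarith⟩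
  linarith

theorem IsFast.exists_hasValue {x : ℕ → ℕ} (hx : IsFast x) : ∃ v, HasValue x v := by
  have hx' : ∀ n i, |(ratOf (x n) : ℝ) - ratOf (x (n + i))| < (1 / 2) ^ n := fun n i => by
    have h : ((|ratOf (x n) - ratOf (x (n + i))| : ℚ) : ℝ) < (((1 / 2) ^ n : ℚ) : ℝ) :=
      Rat.cast_lt.2 (hx n i)
    push_cast at h
    exact h
  have hc : CauchySeq (fun n => (ratOf (x n) : ℝ)) := by
    refine cauchySeq_of_le_geometric (1 / 2) 1 (by norm_num) fun n => ?_
    rw [one_mul, Real.dist_eq]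
    exact (hx' n 1).le
  obtain ⟨v, hv⟩ := cauchySeq_tendsto_of_complete hc
  refine ⟨v, fun n => ?_⟩
  have h := (((Filter.tendsto_add_atTop_iff_nat n).2 hv).const_sub (ratOf (x n) : ℝ)).abs
  refine le_of_tendsto h (Filter.Eventually.of_forall fun i => ?_)
  rw [add_comm i n]
  exact (hx' n i).le

theorem exists_isFast_hasValue (v : ℝ) : ∃ x, IsFast x ∧ HasValue x v := by
  have h : ∀ n : ℕ, ∃ c : ℕ, |(ratOf c : ℝ) - v| < (1 / 2) ^ (n + 1) := fun n => by
    obtain ⟨q, hq1, hq2⟩ := exists_rat_btwn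
      (show v < v + (1 / 2) ^ (n + 1) from lt_add_of_pos_right _ (by positivity))
    obtain ⟨c, rfl⟩ := ratOf_surjective q
    exact ⟨c, abs_lt.2 ⟨by linarith, by linarith⟩⟩
  choose x hx using h
  refine ⟨x, fun n i => ?_, fun n => ?_⟩
  · have h1 := abs_lt.1 (hx n)
    have h2 := abs_lt.1 (hx (n + i))
    have h3 : (1 / 2 : ℝ) ^ (n + i + 1) ≤ (1 / 2) ^ (n + 1) :=
      pow_le_pow_of_le_one (by norm_num) (by norm_num) (by omega)
    have h4 : (1 / 2 : ℝ) ^ n = 2 * (1 / 2) ^ (n + 1) := by rw [pow_succ]; ring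
    have h5 : |(ratOf (x n) : ℝ) - ratOf (x (n + i))| < (1 / 2) ^ n :=
      abs_lt.2 ⟨by linarith, by linarith⟩
    have h6 : ((|ratOf (x n) - ratOf (x (n + i))| : ℚ) : ℝ) < (((1 / 2) ^ n : ℚ) : ℝ) := by
      push_cast
      exact h5
    exact Rat.cast_lt.1 h6
  · exact (hx n).le.trans (pow_le_pow_of_le_one (by norm_num) (by norm_num) (by omega))

/-- The reals with a code in the set `s`. -/
def values (s : Set (ℕ → ℕ)) : Set ℝ := {v | ∃ x ∈ s, HasValue x v}

theorem values_mono {s t : Set (ℕ → ℕ)} (h : s ⊆ t) : values s ⊆ values t :=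
  fun _ ⟨x, hx, hv⟩ => ⟨x, h hx, hv⟩

theorem countable_values {s : Set (ℕ → ℕ)} (hs : s.Countable) : (values s).Countable := by
  have : values s = ⋃ x ∈ s, {v | HasValue x v} := by ext v; simp [values]
  rw [this]
  exact hs.biUnion fun x _ =>
    (show {v | HasValue x v}.Subsingleton from fun v hv w hw => hv.unique hw).countable

/-! ### Closure under countably many operations -/

theorem exists_forall_mem_of_monotone {α : Type*} {T : ℕ → Set α} (hT : Monotone T) {l : List α}
    (hl : ∀ a ∈ l, ∃ n, a ∈ T n) : ∃ n, ∀ a ∈ l, a ∈ T n := by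
  induction l with
  | nil => exact ⟨0, by simp⟩
  | cons b l ih =>
    obtain ⟨n, hn⟩ := ih fun a ha => hl a (List.mem_cons_of_mem _ ha)
    obtain ⟨k, hk⟩ := hl b List.mem_cons_self
    refine ⟨max n k, fun a ha => ?_⟩
    rcases List.mem_cons.1 ha with rfl | ha
    · exact hT (le_max_right _ _) hk
    · exact hT (le_max_left _ _) (hn a ha)

/-- A countable set can be closed under countably many finitary operations within the countable
sets. -/
theorem exists_countable_closed {α : Type*} {ops : Set (List α → α)} (hops : ops.Countable)
    {s : Set α} (hs : s.Countable) :
    ∃ t, s ⊆ t ∧ t.Countable ∧ ∀ o ∈ ops, ∀ l : List α, (∀ a ∈ l, a ∈ t) → o l ∈ t := by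
  let step : Set α → Set α := fun u =>
    u ∪ ⋃ o ∈ ops, Set.range fun l : List u => o (l.map Subtype.val)
  let T : ℕ → Set α := fun n => step^[n] s
  have hsucc : ∀ n, T (n + 1) = step (T n) := fun n => Function.iterate_succ_apply' step n s
  have hmono : Monotone T := monotone_nat_of_le_succ fun n => by
    rw [hsucc]; exact Set.subset_union_left
  have hcount : ∀ n, (T n).Countable := by
    intro n
    induction n with
    | zero => exact hs
    | succ n ih =>
      rw [hsucc]
      have : Countable (T n) := ih
      exact ih.union (hops.biUnion fun o _ => Set.countable_range _)
  refine ⟨⋃ n, T n, Set.subset_iUnion T 0, Set.countable_iUnion hcount, fun o ho l hl => ?_⟩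
  obtain ⟨n, hn⟩ := exists_forall_mem_of_monotone hmono fun a ha => Set.mem_iUnion.1 (hl a ha)
  refine Set.mem_iUnion.2 ⟨n + 1, ?_⟩
  rw [hsucc]
  refine Or.inr (Set.mem_biUnion ho ⟨l.attachWith _ hn, ?_⟩)
  simp

open Classical in
/-- The truth values of the statements that the `i`-th function coded by the head of the list has
the same real value as one of the functions of the tail. -/
noncomputable def valueTest (l : List (ℕ → ℕ)) : ℕ → ℕ := fun i =>
  if ∃ v, HasValue (fun j => l.headD 0 (Nat.pair i j)) v ∧ ∃ g ∈ l.tail, HasValue g v then 1 else 0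

open Classical in
/-- A Skolem function for the first quantifier of the formula `HOA.kleene (k + 1) e`, for which
`f` is the head of the list, and the list of functions its tail: a witness of an existential
quantifier, or a counterexample to a universal one. -/
noncomputable def skolem (k : ℕ) (e : Bool) (l : List (ℕ → ℕ)) : ℕ → ℕ :=
  if h : ∃ g, (kleeneTrue Set.univ k (!e) (l.headD 0) (l.tail ++ [g]) ↔ e = true) then h.choose
  else 0

/-- The operations under which the levels of the chain are closed. -/
def operations : Set (List (ℕ → ℕ) → ℕ → ℕ) :=
  {fun _ _ => 0, fun _ => Nat.succ, fun _ i => i.unpair.1, fun _ i => i.unpair.2,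
    fun l i => l.getD 0 0 (l.getD 1 0 i),
    fun l i => Nat.pair (l.getD 0 0 i) (l.getD 1 0 i),
    fun l a => Nat.rec (motive := fun _ => ℕ) (l.getD 0 0 a.unpair.1)
      (fun y r => l.getD 1 0 (Nat.pair a.unpair.1 (Nat.pair y r))) a.unpair.2,
    fun l a => sInf {n | l.getD 0 0 (Nat.pair a n) = 0},
    valueTest} ∪
  Set.range (fun k l => jump Set.univ k (l.headD 0)) ∪
  Set.range (fun p : ℕ × Bool => skolem p.1 p.2)

theorem countable_operations : operations.Countable :=
  ((Set.toFinite _).countable.union (Set.countable_range _)).union (Set.countable_range _)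

/-- Closure under the operations. -/
def IsClosedSet (s : Set (ℕ → ℕ)) : Prop :=
  ∀ o ∈ operations, ∀ l : List (ℕ → ℕ), (∀ f ∈ l, f ∈ s) → o l ∈ s

namespace IsClosedSet
variable {s : Set (ℕ → ℕ)} (hs : IsClosedSet s)
include hs

theorem recClosed : RecClosed s := by
  have hcomp : ∀ f ∈ s, ∀ g ∈ s, (fun i => f (g i)) ∈ s := fun f hf g hg =>
    hs (fun l i => l.getD 0 0 (l.getD 1 0 i)) (by simp [operations]) [f, g] (by simp [hf, hg])
  have hpair : ∀ f ∈ s, ∀ g ∈ s, (fun i => Nat.pair (f i) (g i)) ∈ s := fun f hf g hg =>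
    hs (fun l i => Nat.pair (l.getD 0 0 i) (l.getD 1 0 i)) (by simp [operations]) [f, g]
      (by simp [hf, hg])
  have hprec : ∀ f ∈ s, ∀ g ∈ s, (fun a : ℕ => Nat.rec (motive := fun _ => ℕ) (f a.unpair.1)
      (fun y r => g (Nat.pair a.unpair.1 (Nat.pair y r))) a.unpair.2) ∈ s := fun f hf g hg =>
    hs (fun l a => Nat.rec (motive := fun _ => ℕ) (l.getD 0 0 a.unpair.1)
      (fun y r => l.getD 1 0 (Nat.pair a.unpair.1 (Nat.pair y r))) a.unpair.2)
      (by simp [operations]) [f, g] (by simp [hf, hg])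
  refine ⟨fun f hf => ?_, hcomp, hpair, hprec, fun f hf =>
    hs (fun l a => sInf {n | l.getD 0 0 (Nat.pair a n) = 0}) (by simp [operations]) [f]
      (by simp [hf])⟩
  induction hf with
  | zero => exact hs (fun _ _ => 0) (by simp [operations]) [] (by simp)
  | succ => exact hs (fun _ => Nat.succ) (by simp [operations]) [] (by simp)
  | left => exact hs (fun _ i => i.unpair.1) (by simp [operations]) [] (by simp)
  | right => exact hs (fun _ i => i.unpair.2) (by simp [operations]) [] (by simp)
  | pair _ _ h1 h2 => exact hpair _ h1 _ h2
  | comp _ _ h1 h2 => exact hcomp _ h1 _ h2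
  | prec _ _ h1 h2 => exact hprec _ h1 _ h2

theorem valueTest_mem {l : List (ℕ → ℕ)} (hl : ∀ f ∈ l, f ∈ s) : valueTest l ∈ s :=
  hs _ (by simp [operations]) l hl

theorem jump_mem (k : ℕ) {f : ℕ → ℕ} (hf : f ∈ s) : jump Set.univ k f ∈ s :=
  hs _ (Or.inl (Or.inr ⟨k, rfl⟩)) [f] (by simp [hf])

theorem skolem_mem (k : ℕ) (e : Bool) {l : List (ℕ → ℕ)} (hl : ∀ f ∈ l, f ∈ s) :
    skolem k e l ∈ s :=
  hs _ (Or.inr ⟨(k, e), rfl⟩) l hl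

/-- A closed set is an elementary submodel of the set of all functions, by the criterion of
Tarski and Vaught. -/
theorem kleeneTrue_iff : ∀ (k : ℕ) (e : Bool) (f : ℕ → ℕ) (gs : List (ℕ → ℕ)), f ∈ s →
    (∀ g ∈ gs, g ∈ s) → (kleeneTrue s k e f gs ↔ kleeneTrue Set.univ k e f gs)
  | 0, true, _, _, _, _ => Iff.rfl
  | 0, false, _, _, _, _ => Iff.rfl
  | k + 1, true, f, gs, hf, hgs => by
    have ih : ∀ g ∈ s, (kleeneTrue s k false f (gs ++ [g]) ↔
        kleeneTrue Set.univ k false f (gs ++ [g])) := fun g hg =>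
      kleeneTrue_iff k false f _ hf (by
        intro a ha
        rcases List.mem_append.1 ha with ha | ha
        · exact hgs a ha
        · rwa [List.mem_singleton.1 ha])
    constructor
    · rintro ⟨g, hg, h⟩
      exact ⟨g, trivial, (ih g hg).1 h⟩
    · rintro ⟨g, -, h⟩
      have hex : ∃ g, (kleeneTrue Set.univ k (!true) ((f :: gs).headD 0)
          ((f :: gs).tail ++ [g]) ↔ true = true) := ⟨g, iff_of_true h rfl⟩
      have hmem := hs.skolem_mem k true (l := f :: gs) (by simpa using ⟨hf, hgs⟩)
      refine ⟨_, hmem, (ih _ hmem).2 ?_⟩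
      rw [skolem, dif_pos hex]
      exact hex.choose_spec.2 rfl
  | k + 1, false, f, gs, hf, hgs => by
    have ih : ∀ g ∈ s, (kleeneTrue s k true f (gs ++ [g]) ↔
        kleeneTrue Set.univ k true f (gs ++ [g])) := fun g hg =>
      kleeneTrue_iff k true f _ hf (by
        intro a ha
        rcases List.mem_append.1 ha with ha | ha
        · exact hgs a ha
        · rwa [List.mem_singleton.1 ha])
    constructor
    · intro h
      by_contra hnot
      simp only [kleeneTrue, Set.mem_univ, true_imp_iff, not_forall] at hnot
      obtain ⟨g, hg⟩ := hnot
      have hex : ∃ g, (kleeneTrue Set.univ k (!false) ((f :: gs).headD 0)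
          ((f :: gs).tail ++ [g]) ↔ false = true) := ⟨g, iff_of_false hg (by simp)⟩
      have hmem := hs.skolem_mem k false (l := f :: gs) (by simpa using ⟨hf, hgs⟩)
      have h1 := (ih _ hmem).1 (h _ hmem)
      rw [skolem, dif_pos hex] at h1
      exact absurd (hex.choose_spec.1 h1) (by simp)
    · intro h g hg
      exact (ih g hg).2 (h g trivial)

end IsClosedSet

theorem isClosedSet_iUnion {T : ℕ → Set (ℕ → ℕ)} (hT : Monotone T) (h : ∀ n, IsClosedSet (T n)) :
    IsClosedSet {f | ∃ n, f ∈ T n} := by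
  intro o ho l hl
  obtain ⟨n, hn⟩ := exists_forall_mem_of_monotone hT hl
  exact ⟨n, h n o ho l hn⟩

/-- Each countable set has a countable closed extension such that the reals with a code in the
extension and without a code in the given set are dense. -/
theorem exists_extension {s : Set (ℕ → ℕ)} (hs : s.Countable) :
    ∃ t, s ⊆ t ∧ t.Countable ∧ IsClosedSet t ∧ ∀ U : Set ℝ, IsOpen U → U.Nonempty →
      ∃ v ∈ U, v ∉ values s ∧ ∃ x ∈ t, IsFast x ∧ HasValue x v := by
  have h : ∀ p : {p : ℚ × ℚ // p.1 < p.2}, ∃ x, IsFast x ∧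
      ∃ v, HasValue x v ∧ v ∉ values s ∧ (p.1.1 : ℝ) < v ∧ v < (p.1.2 : ℝ) := fun p => by
    obtain ⟨v, hv, hp⟩ := ((countable_values hs).dense_compl ℝ).exists_between
      (show (p.1.1 : ℝ) < p.1.2 from Rat.cast_lt.2 p.2)
    obtain ⟨x, hx, hxv⟩ := exists_isFast_hasValue v
    exact ⟨x, hx, v, hxv, hv, hp.1, hp.2⟩
  choose x hx v hv using h
  obtain ⟨t, hst, ht, hcl⟩ := exists_countable_closed countable_operations
    (hs.union (Set.countable_range x))
  refine ⟨t, fun f hf => hst (Or.inl hf), ht, hcl, fun U hU ⟨u, hu⟩ => ?_⟩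
  obtain ⟨ε, hε, hball⟩ := Metric.isOpen_iff.1 hU u hu
  obtain ⟨p, hp1, hp2⟩ := exists_rat_btwn (show u - ε < u by linarith)
  obtain ⟨q, hq1, hq2⟩ := exists_rat_btwn (show u < u + ε by linarith)
  let pq : {p : ℚ × ℚ // p.1 < p.2} :=
    ⟨(p, q), by have : (p : ℝ) < q := hp2.trans hq1
                exact_mod_cast this⟩
  obtain ⟨h1, h2, h3, h4⟩ := hv pq
  refine ⟨v pq, hball ?_, h2, x pq, hst (Or.inr ⟨pq, rfl⟩), hx pq, h1⟩
  rw [Metric.mem_ball, Real.dist_eq, abs_lt]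
  have h3' : (p : ℝ) < v pq := h3
  have h4' : v pq < (q : ℝ) := h4
  exact ⟨by linarith, by linarith⟩

/-- The properties of the chain that the counterexample to the Heine-Borel theorem needs: the
levels are countable and closed, and each level has new reals in each open set. -/
structure IsGoodChain (𝒜 : Chain) : Prop where
  countable : ∀ n, (𝒜.level n).Countable
  isClosedSet : ∀ n, IsClosedSet (𝒜.level n)
  dense : ∀ n, ∀ U : Set ℝ, IsOpen U → U.Nonempty → ∃ v ∈ U, v ∉ values (𝒜.level n) ∧
    ∃ x ∈ 𝒜.level (n + 1), IsFast x ∧ HasValue x v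

theorem exists_isGoodChain {s : Set (ℕ → ℕ)} (hs : s.Countable) :
    ∃ 𝒜 : Chain, IsGoodChain 𝒜 ∧ s ⊆ 𝒜.level 0 := by
  choose next hn1 hn2 hn3 hn4 using fun s : {s : Set (ℕ → ℕ) // s.Countable} =>
    exists_extension s.2
  let T : ℕ → {s : Set (ℕ → ℕ) // s.Countable} := fun n =>
    Nat.rec ⟨next ⟨s, hs⟩, hn2 _⟩ (fun _ t => ⟨next t, hn2 t⟩) n
  have hclosed : ∀ n, IsClosedSet (T n).1 := fun n => by
    cases n with
    | zero => exact hn3 _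
    | succ n => exact hn3 _
  exact ⟨⟨fun n => (T n).1, monotone_nat_of_le_succ fun n => hn1 (T n),
    fun n => (hclosed n).recClosed⟩, ⟨fun n => (T n).2, hclosed, fun n => hn4 (T n)⟩, hn1 ⟨s, hs⟩⟩

/-- The model given by a good chain is a model of `Z_2^ω`. -/
theorem IsGoodChain.sat_Z2ω {𝒜 : Chain} (h𝒜 : IsGoodChain 𝒜) {φ : Sentence} (hφ : φ ∈ Z2ω) :
    φ.Sat (𝒜 := 𝒜) Env.nil := by
  obtain ⟨k, hk⟩ := Set.mem_iUnion.1 hφ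
  rcases hk with hk | hk
  · exact sat_RCA0ω hk
  · rw [Set.mem_singleton_iff.1 hk]
    refine sat_existsS k fun m f hf => ?_
    have hU := isClosedSet_iUnion 𝒜.mono h𝒜.isClosedSet
    convert (h𝒜.isClosedSet m).jump_mem k hf using 1
    funext i
    have hfi : (fun j => f (Nat.pair i j)) ∈ 𝒜.level m :=
      (𝒜.closed m).comp f hf _ ((𝒜.closed m).pair _ ((𝒜.closed m).const i) _ (𝒜.closed m).id)
    have := hU.kleeneTrue_iff k true _ [] ⟨m, hfi⟩ (by simp)
    classical exact if_congr this rfl rfl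

variable {Γ : List Ty} (ρ : Env 𝒜 Γ)

/-! ### Truth of the formulas about reals -/

@[simp] theorem Term.toNat_fst (c : Term Γ N) :
    ((fst c).eval ρ).toNat = cantorFst (c.eval ρ).toNat := by
  simp [fst, cantorFst]

@[simp] theorem Term.toNat_snd (c : Term Γ N) :
    ((snd c).eval ρ).toNat = cantorSnd (c.eval ρ).toNat := by
  simp [snd, cantorSnd]

namespace QTerm

/-- The rational number that is the value of a signed quotient of terms. -/
def val (p : QTerm Γ) : ℚ :=
  (((p.pos.eval ρ).toNat : ℚ) - ((p.neg.eval ρ).toNat : ℚ)) / ((p.den.eval ρ).toNat : ℚ)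

/-- The denominator is positive. -/
def DenPos (p : QTerm Γ) : Prop := 0 < (p.den.eval ρ).toNat

variable {ρ} {p q : QTerm Γ}

theorem denPos_ofCode (c : Term Γ N) : (ofCode c).DenPos ρ := by simp [DenPos, ofCode]

theorem denPos_zero : (zero : QTerm Γ).DenPos ρ := by simp [DenPos, zero]

theorem denPos_twoNeg (n : Term Γ N) : (twoNeg n).DenPos ρ := by simp [DenPos, twoNeg]

theorem denPos_twoNegAddOne (n : Term Γ N) : (twoNegAddOne n).DenPos ρ := by
  simp [DenPos, twoNegAddOne]

theorem DenPos.opp (hp : p.DenPos ρ) : p.opp.DenPos ρ := hp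

theorem DenPos.add (hp : p.DenPos ρ) (hq : q.DenPos ρ) : (p.add q).DenPos ρ := by
  simpa [DenPos, QTerm.add] using ⟨hp, hq⟩

theorem DenPos.sub (hp : p.DenPos ρ) (hq : q.DenPos ρ) : (p.sub q).DenPos ρ := hp.add hq.opp

theorem val_ofCode (c : Term Γ N) : (ofCode c).val ρ = ratOf (c.eval ρ).toNat := by
  simp [val, ofCode, ratOf]

theorem val_zero : (zero : QTerm Γ).val ρ = 0 := by simp [val, zero]

theorem val_twoNeg (n : Term Γ N) : (twoNeg n).val ρ = (1 / 2) ^ (n.eval ρ).toNat := by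
  simp [val, twoNeg]

theorem val_twoNegAddOne (n : Term Γ N) :
    (twoNegAddOne n).val ρ = 2 * (1 / 2) ^ (n.eval ρ).toNat := by
  simp [val, twoNegAddOne, div_eq_mul_inv]

theorem val_opp : p.opp.val ρ = - p.val ρ := by
  simp only [val, opp]; ring

theorem val_add (hp : p.DenPos ρ) (hq : q.DenPos ρ) : (p.add q).val ρ = p.val ρ + q.val ρ := by
  have h1 : ((p.den.eval ρ).toNat : ℚ) ≠ 0 := by exact_mod_cast (show 0 < _ from hp).ne'
  have h2 : ((q.den.eval ρ).toNat : ℚ) ≠ 0 := by exact_mod_cast (show 0 < _ from hq).ne'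
  simp only [val, add, Term.toNat_add, Term.toNat_mul]
  push_cast
  field_simp
  ring

theorem val_sub (hp : p.DenPos ρ) (hq : q.DenPos ρ) : (p.sub q).val ρ = p.val ρ - q.val ρ := by
  rw [sub, val_add hp hq.opp, val_opp, sub_eq_add_neg]

theorem sat_lt (hp : p.DenPos ρ) (hq : q.DenPos ρ) : (p.lt q).Sat ρ ↔ p.val ρ < q.val ρ := by
  have h1 : (0 : ℚ) < (p.den.eval ρ).toNat := by exact_mod_cast hp
  have h2 : (0 : ℚ) < (q.den.eval ρ).toNat := by exact_mod_cast hq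
  rw [val, val, div_lt_div_iff₀ h1 h2, QTerm.lt, Formula.sat_lt, ← Nat.cast_lt (α := ℚ)]
  simp only [Term.toNat_add, Term.toNat_mul]
  push_cast
  constructor <;> intro h <;> linarith

theorem sat_le (hp : p.DenPos ρ) (hq : q.DenPos ρ) : (p.le q).Sat ρ ↔ p.val ρ ≤ q.val ρ := by
  have h1 : (0 : ℚ) < (p.den.eval ρ).toNat := by exact_mod_cast hp
  have h2 : (0 : ℚ) < (q.den.eval ρ).toNat := by exact_mod_cast hq
  rw [val, val, div_le_div_iff₀ h1 h2, QTerm.le, Formula.sat_le, ← Nat.cast_le (α := ℚ)]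
  simp only [Term.toNat_add, Term.toNat_mul]
  push_cast
  constructor <;> intro h <;> linarith

theorem sat_absLt (hp : p.DenPos ρ) (hq : q.DenPos ρ) :
    (p.absLt q).Sat ρ ↔ |p.val ρ| < q.val ρ := by
  rw [absLt, Formula.sat_and, sat_lt hp hq, sat_lt hp.opp hq, val_opp, abs_lt, neg_lt, and_comm]

theorem sat_absLe (hp : p.DenPos ρ) (hq : q.DenPos ρ) :
    (p.absLe q).Sat ρ ↔ |p.val ρ| ≤ q.val ρ := by
  rw [absLe, Formula.sat_and, sat_le hp hq, sat_le hp.opp hq, val_opp, abs_le, neg_le, and_comm]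

end QTerm

theorem denPos_approx (x : Term Γ N1) (n : Term Γ N) : (approx x n).DenPos ρ :=
  QTerm.denPos_ofCode _

theorem val_approx (x : Term Γ N1) (n : Term Γ N) :
    (approx x n).val ρ = ratOf ((x.eval ρ).toFun (n.eval ρ).toNat) :=
  QTerm.val_ofCode _

theorem sat_isReal (x : Term Γ N1) : (isReal x).Sat ρ ↔ IsFast (x.eval ρ).toFun := by
  simp only [isReal, Formula.sat_all, Val.forall_nat, IsFast]
  refine forall_congr' fun n => forall_congr' fun i => ?_
  rw [QTerm.sat_absLt ((denPos_approx _ _ _).sub (denPos_approx _ _ _)) (QTerm.denPos_twoNeg _),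
    QTerm.val_sub (denPos_approx _ _ _) (denPos_approx _ _ _), QTerm.val_twoNeg]
  simp [val_approx]

theorem sat_allReal (φ : Formula (N1 :: Γ)) :
    (allReal φ).Sat ρ ↔ ∀ x : Val 𝒜 N1, IsFast x.toFun → φ.Sat (ρ.cons x) := by
  simp only [allReal, Formula.sat_all, Formula.sat_imp, sat_isReal, Term.eval_var, Env.cons_z]

variable {ρ}

theorem sat_realEq {x y : Term Γ N1} {v w : ℝ} (hx : HasValue (x.eval ρ).toFun v)
    (hy : HasValue (y.eval ρ).toFun w) : (realEq x y).Sat ρ ↔ v = w := by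
  have h1 : (realEq x y).Sat ρ ↔ ∀ n : ℕ, |ratOf ((x.eval ρ).toFun n) - ratOf ((y.eval ρ).toFun n)|
      ≤ 2 * (1 / 2) ^ n := by
    simp only [realEq, Formula.sat_all, Val.forall_nat]
    refine forall_congr' fun n => ?_
    rw [QTerm.sat_absLe ((denPos_approx _ _ _).sub (denPos_approx _ _ _))
      (QTerm.denPos_twoNegAddOne _), QTerm.val_sub (denPos_approx _ _ _) (denPos_approx _ _ _),
      QTerm.val_twoNegAddOne]
    simp [val_approx]
  have h2 : (realEq x y).Sat ρ ↔ ∀ n : ℕ,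
      |(ratOf ((x.eval ρ).toFun n) : ℝ) - ratOf ((y.eval ρ).toFun n)| ≤ 2 * (1 / 2) ^ n := by
    rw [h1]
    refine forall_congr' fun n => ?_
    rw [← Rat.cast_le (K := ℝ)]
    push_cast
    rfl
  rw [h2]
  constructor
  · intro h
    by_contra hne
    obtain ⟨n, hn⟩ := eventually_two_mul_half_pow_lt (abs_pos.2 (sub_ne_zero.2 hne)) 4
    have h1 := abs_le.1 (hx n)
    have h2 := abs_le.1 (hy n)
    have h3 := abs_le.1 (h n)
    have : |v - w| ≤ 4 * (1 / 2) ^ n := abs_le.2 ⟨by linarith, by linarith⟩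
    linarith
  · rintro rfl n
    have h1 := abs_le.1 (hx n)
    have h2 := abs_le.1 (hy n)
    exact abs_le.2 ⟨by linarith, by linarith⟩

theorem sat_realLt {x y : Term Γ N1} {v w : ℝ} (hx : HasValue (x.eval ρ).toFun v)
    (hy : HasValue (y.eval ρ).toFun w) : (realLt x y).Sat ρ ↔ v < w := by
  have h1 : (realLt x y).Sat ρ ↔ ∃ n : ℕ, ratOf ((x.eval ρ).toFun n) + 2 * (1 / 2) ^ n <
      ratOf ((y.eval ρ).toFun n) := by
    simp only [realLt, Formula.sat_ex, Val.exists_nat]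
    refine exists_congr fun n => ?_
    rw [QTerm.sat_lt ((denPos_approx _ _ _).add (QTerm.denPos_twoNegAddOne _))
      (denPos_approx _ _ _), QTerm.val_add (denPos_approx _ _ _) (QTerm.denPos_twoNegAddOne _),
      QTerm.val_twoNegAddOne]
    simp [val_approx]
  have h2 : (realLt x y).Sat ρ ↔ ∃ n : ℕ, (ratOf ((x.eval ρ).toFun n) : ℝ) + 2 * (1 / 2) ^ n <
      ratOf ((y.eval ρ).toFun n) := by
    rw [h1]
    refine exists_congr fun n => ?_
    rw [← Rat.cast_lt (K := ℝ)]
    push_cast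
    rfl
  rw [h2]
  constructor
  · rintro ⟨n, hn⟩
    have h1 := abs_le.1 (hx n)
    have h2 := abs_le.1 (hy n)
    linarith
  · intro h
    obtain ⟨n, hn⟩ := eventually_two_mul_half_pow_lt (sub_pos.2 h) 4
    have h1 := abs_le.1 (hx n)
    have h2 := abs_le.1 (hy n)
    exact ⟨n, by linarith⟩

theorem sat_distLt {x y : Term Γ N1} {r : Term Γ N} {v w : ℝ} (hx : HasValue (x.eval ρ).toFun v)
    (hy : HasValue (y.eval ρ).toFun w) :
    (distLt x y r).Sat ρ ↔ |v - w| < ratOf (r.eval ρ).toNat := by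
  have h1 : (distLt x y r).Sat ρ ↔ ∃ n : ℕ,
      |ratOf ((x.eval ρ).toFun n) - ratOf ((y.eval ρ).toFun n)| <
        ratOf (r.eval ρ).toNat - 2 * (1 / 2) ^ n := by
    simp only [distLt, Formula.sat_ex, Val.exists_nat]
    refine exists_congr fun n => ?_
    rw [QTerm.sat_absLt ((denPos_approx _ _ _).sub (denPos_approx _ _ _))
      ((QTerm.denPos_ofCode _).sub (QTerm.denPos_twoNegAddOne _)),
      QTerm.val_sub (denPos_approx _ _ _) (denPos_approx _ _ _),
      QTerm.val_sub (QTerm.denPos_ofCode _) (QTerm.denPos_twoNegAddOne _), QTerm.val_ofCode,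
      QTerm.val_twoNegAddOne]
    simp [val_approx]
  have h2 : (distLt x y r).Sat ρ ↔ ∃ n : ℕ,
      |(ratOf ((x.eval ρ).toFun n) : ℝ) - ratOf ((y.eval ρ).toFun n)| <
        ratOf (r.eval ρ).toNat - 2 * (1 / 2) ^ n := by
    rw [h1]
    refine exists_congr fun n => ?_
    rw [← Rat.cast_lt (K := ℝ)]
    push_cast
    rfl
  rw [h2]
  constructor
  · rintro ⟨n, hn⟩
    have h1 := abs_le.1 (hx n)
    have h2 := abs_le.1 (hy n)
    have h3 := abs_lt.1 hn
    exact abs_lt.2 ⟨by linarith, by linarith⟩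
  · intro h
    obtain ⟨n, hn⟩ := eventually_two_mul_half_pow_lt (sub_pos.2 h) 4
    have h1 := abs_le.1 (hx n)
    have h2 := abs_le.1 (hy n)
    have h3 := le_abs_self (v - w)
    have h4 := neg_abs_le (v - w)
    exact ⟨n, abs_lt.2 ⟨by linarith, by linarith⟩⟩

theorem ratOf_zero : ratOf 0 = 0 := by
  rw [show (0 : ℕ) = cantorPair 0 0 from rfl, ratOf, cantorFst_cantorPair, cantorSnd_cantorPair]
  simp

theorem ratOf_cantorPair_two_zero : ratOf (cantorPair 2 0) = 1 := by
  rw [ratOf, cantorFst_cantorPair, cantorSnd_cantorPair]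
  simp

theorem isFast_const (c : ℕ) : IsFast (fun _ => c) := fun n _ => by
  rw [sub_self, abs_zero]; positivity

theorem hasValue_const (c : ℕ) : HasValue (fun _ => c) (ratOf c) := fun n => by
  rw [sub_self, abs_zero]; positivity

theorem hasValue_realZero : HasValue ((realZero : Term Γ N1).eval ρ).toFun 0 := by
  have h := hasValue_const 0
  rw [ratOf_zero, Rat.cast_zero] at h
  exact h

theorem hasValue_realOne : HasValue ((realOne : Term Γ N1).eval ρ).toFun 1 := by
  have h := hasValue_const (cantorPair 2 0)
  rw [ratOf_cantorPair_two_zero, Rat.cast_one] at h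
  have : ((realOne : Term Γ N1).eval ρ).toFun = fun _ => cantorPair 2 0 :=
    funext fun _ => Term.toNat_pair ρ (1 + 1) 0
  rwa [this]

-- Unification of values of terms must not unfold these functions.
attribute [local irreducible] ratOf cantorPair HasValue IsFast

/-! ### Functionals that represent sets of reals -/

/-- The functional `F` maps the codes of a real to codes of the value of the characteristic
function of `C` at this real. -/
def Represents (F : Val 𝒜 (N1 ⇒ N1)) (C : Set ℝ) : Prop :=
  ∀ (x : Val 𝒜 N1) (v : ℝ), HasValue x.toFun v →
    IsFast (F.app x).toFun ∧ HasValue (F.app x).toFun (C.indicator 1 v)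

theorem sat_mem {C : Set ℝ} {x : Term Γ N1} {Y : Term Γ (N1 ⇒ N1)}
    (hY : Represents (Y.eval ρ) C) {v : ℝ} (hx : HasValue (x.eval ρ).toFun v) :
    (mem x Y).Sat ρ ↔ v ∈ C := by
  have h : HasValue ((Y x).eval ρ).toFun (C.indicator 1 v) := (hY _ v hx).2
  rw [mem, sat_realLt hasValue_realZero h]
  by_cases hv : v ∈ C <;> simp [hv]

theorem sat_isRealFun {C : Set ℝ} {Y : Term Γ (N1 ⇒ N1)} (hY : Represents (Y.eval ρ) C) :
    (isRealFun Y).Sat ρ := by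
  rw [isRealFun, Formula.sat_and]
  constructor
  · rw [sat_allReal]
    intro x hx
    obtain ⟨v, hv⟩ := hx.exists_hasValue
    rw [sat_isReal, Term.eval_app, Term.eval_wk]
    exact (hY x v hv).1
  · simp only [sat_allReal, Formula.sat_imp]
    intro x hx y hy hxy
    obtain ⟨v, hv⟩ := hx.exists_hasValue
    obtain ⟨w, hw⟩ := hy.exists_hasValue
    have hvw : v = w := (sat_realEq (by exact hv) (by exact hw)).1 hxy
    subst hvw
    refine (sat_realEq (v := C.indicator 1 v) (w := C.indicator 1 v) ?_ ?_).2 rfl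
    · rw [Term.eval_app, Term.eval_wk, Term.eval_wk]
      exact (hY x v hv).2
    · rw [Term.eval_app, Term.eval_wk, Term.eval_wk]
      exact (hY y v hw).2

/-- It suffices that the set is closed relative to the reals of the model. -/
theorem sat_isClosed {C : Set ℝ} {Y : Term Γ (N1 ⇒ N1)} (hY : Represents (Y.eval ρ) C)
    (hC : ∀ n, ∀ v ∈ values (𝒜.level n), v ∉ C → ∃ ε > 0, ∀ w ∈ C, ε ≤ |v - w|) :
    (isClosed Y).Sat ρ := by
  rw [isClosed, sat_allReal]
  intro x hx hmem
  obtain ⟨v, hv⟩ := hx.exists_hasValue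
  have hvC : v ∉ C := fun hvC => hmem
    ((sat_mem (C := C) (by simpa only [Term.eval_wk] using hY) (by exact hv)).2 hvC)
  obtain ⟨n, hn⟩ := x.toFun_mem
  obtain ⟨ε, hε, hball⟩ := hC n v ⟨_, hn, hv⟩ hvC
  obtain ⟨q, hq1, hq2⟩ := exists_rat_btwn hε
  obtain ⟨c, rfl⟩ := ratOf_surjective q
  rw [Formula.sat_ex]
  refine ⟨Val.ofNat c, ?_⟩
  rw [Formula.sat_and, QTerm.sat_lt QTerm.denPos_zero (QTerm.denPos_ofCode _), QTerm.val_zero,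
    QTerm.val_ofCode, sat_allReal]
  refine ⟨by simpa using (Rat.cast_pos (K := ℝ)).1 hq1, fun y hy hdist => ?_⟩
  obtain ⟨w, hw⟩ := hy.exists_hasValue
  intro hmem'
  have h1 := hball w
    ((sat_mem (C := C) (by simpa only [Term.eval_wk] using hY) (by exact hw)).1 hmem')
  have h2 : |v - w| < ratOf c :=
    (sat_distLt (v := v) (w := w) (by exact hv) (by exact hw)).1 hdist
  linarith

theorem sat_inUnitInterval {C : Set ℝ} {Y : Term Γ (N1 ⇒ N1)} (hY : Represents (Y.eval ρ) C)
    (hC : C ⊆ Set.Icc 0 1) : (inUnitInterval Y).Sat ρ := by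
  rw [inUnitInterval, sat_allReal]
  intro x hx hmem
  obtain ⟨v, hv⟩ := hx.exists_hasValue
  have hvC : v ∈ C :=
    (sat_mem (C := C) (by simpa only [Term.eval_wk] using hY) (by exact hv)).1 hmem
  rw [Formula.sat_and, Formula.sat_neg, Formula.sat_neg]
  exact ⟨fun h => not_lt.2 (hC hvC).1 ((sat_realLt (by exact hv) hasValue_realZero).1 h),
    fun h => not_lt.2 (hC hvC).2 ((sat_realLt hasValue_realOne (by exact hv)).1 h)⟩

/-- A set of reals is represented in the model if each level can compute its trace on the reals
of this level from a finite list of codes of elements. -/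
theorem exists_represents {C : Set ℝ} (h𝒜 : ∀ n, IsClosedSet (𝒜.level n))
    (hC : ∀ n, ∃ l : List (ℕ → ℕ), (∀ g ∈ l, g ∈ 𝒜.level n) ∧
      ∀ v ∈ values (𝒜.level n), v ∈ C ↔ ∃ g ∈ l, HasValue g v) :
    ∃ F : Val 𝒜 (N1 ⇒ N1), Represents F C := by
  classical
  let χ : Val 𝒜 N1 → ℕ := fun x => if ∃ v ∈ C, HasValue x.toFun v then cantorPair 2 0 else 0
  let F : Val 𝒜 N1 → Val 𝒜 N1 := fun x =>
    Val.ofFun (fun _ => χ x) ⟨0, (𝒜.closed 0).const _⟩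
  have hF : ∀ m, 0 ≤ m → ∀ x, (N1.space 𝒜).plot m x → (N1.space 𝒜).plot m (fun i => F (x i)) := by
    intro m _ (x : ℕ → Val 𝒜 N1) hx
    obtain ⟨l, hl, hlC⟩ := hC m
    have hflat : (fun n : ℕ => (x n.unpair.1).toFun n.unpair.2) ∈ 𝒜.level m :=
      plot_arr_nat_iff.1 hx
    have hxi : ∀ i, (x i).toFun ∈ 𝒜.level m := fun i =>
      (𝒜.closed m).uncurried (p := fun i => (x i).toFun) hflat ((𝒜.closed m).const i) (𝒜.closed m).id
    have htest := (h𝒜 m).valueTest_mem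
      (l := (fun n : ℕ => (x n.unpair.1).toFun n.unpair.2) :: l) (by simpa using ⟨hflat, hl⟩)
    have hp : Primrec₂ (fun a _ : ℕ => a * cantorPair 2 0) :=
      Primrec.nat_mul.comp Primrec.fst (Primrec.const _)
    have hχ : (fun i => χ (x i)) ∈ 𝒜.level m := by
      convert (𝒜.closed m).comp₂ hp htest htest using 2 with i
      have hiff : (∃ v ∈ C, HasValue (x i).toFun v) ↔
          ∃ v, HasValue (x i).toFun v ∧ ∃ g ∈ l, HasValue g v :=
        exists_congr fun v => ⟨fun ⟨h1, h2⟩ => ⟨h2, (hlC v ⟨_, hxi i, h2⟩).1 h1⟩,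
          fun ⟨h1, h2⟩ => ⟨(hlC v ⟨_, hxi i, h1⟩).2 h2, h1⟩⟩
      by_cases h : ∃ v ∈ C, HasValue (x i).toFun v
      · have h' := hiff.1 h
        simp only [χ, if_pos h, valueTest, List.headD_cons, List.tail_cons, Nat.unpair_pair]
        rw [if_pos h', one_mul]
      · have h' := fun h' => h (hiff.2 h')
        simp only [χ, if_neg h, valueTest, List.headD_cons, List.tail_cons, Nat.unpair_pair]
        rw [if_neg h', zero_mul]
    exact plot_arr_nat_iff.2 ((𝒜.closed m).comp _ hχ _ (𝒜.closed m).left)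
  refine ⟨(⟨F, 0, hF⟩ : (arr (N1.space 𝒜) (N1.space 𝒜)).carrier), fun x v hv => ⟨isFast_const (χ x), ?_⟩⟩
  have hval := hasValue_const (χ x)
  have hχ : (ratOf (χ x) : ℝ) = C.indicator 1 v := by
    by_cases hvC : v ∈ C
    · have h : ∃ w ∈ C, HasValue x.toFun w := ⟨v, hvC, hv⟩
      simp only [χ, if_pos h, ratOf_cantorPair_two_zero, Set.indicator_of_mem hvC]
      simp
    · have h : ¬ ∃ w ∈ C, HasValue x.toFun w := fun ⟨w, hw, hxw⟩ => hvC (hv.unique hxw ▸ hw)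
      simp only [χ, if_neg h, ratOf_zero, Set.indicator_of_notMem hvC]
      simp
  rw [hχ] at hval
  exact hval

/-- The sequence of the rational reals whose codes are given by a function of the chain. -/
def ratSeq {n : ℕ} (f : ℕ → ℕ) (hf : f ∈ 𝒜.level n) : Val 𝒜 (N ⇒ N1) :=
  curry₂ (X := Space.nat 𝒜) (Y := Space.nat 𝒜) (Z := Space.nat 𝒜) (fun i _ => f i)
    ⟨n, fun m hm x _ hx _ => (𝒜.closed m).comp f (𝒜.mono hm hf) x hx⟩

theorem toFun_ratSeq_app {n : ℕ} {f : ℕ → ℕ} (hf : f ∈ 𝒜.level n) (i : Val 𝒜 N) :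
    ((ratSeq f hf).app i).toFun = fun _ => f i.toNat := rfl

/-! ### The failure of the Heine-Borel theorem -/

/-- Open intervals that are centred at the rational numbers, of total length `1 / 2`. -/
def smallInterval (n : ℕ) : Set ℝ :=
  Set.Ioo ((ratOf n : ℝ) - (1 / 2) ^ (n + 3)) (ratOf n + (1 / 2) ^ (n + 3))

theorem volume_iUnion_smallInterval :
    MeasureTheory.volume (⋃ n, smallInterval n) ≤ ENNReal.ofReal (1 / 2) := by
  have hvol : ∀ n, MeasureTheory.volume (smallInterval n) =
      ENNReal.ofReal (1 / 4 * (1 / 2) ^ n) := fun n => by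
    rw [smallInterval, Real.volume_Ioo]
    congr 1
    rw [pow_add]; ring
  have hs : HasSum (fun n : ℕ => 1 / 4 * (1 / 2 : ℝ) ^ n) (1 / 4 * 2) :=
    hasSum_geometric_two.mul_left _
  refine (MeasureTheory.measure_iUnion_le _).trans ?_
  simp only [hvol]
  rw [← ENNReal.ofReal_tsum_of_nonneg (fun n => by positivity) hs.summable, hs.tsum_eq]
  norm_num

theorem exists_notMem_smallInterval {B : Set ℝ} (hB : B.Countable) :
    ∃ z ∈ Set.Ioo (0 : ℝ) 1, z ∉ B ∧ ∀ n, z ∉ smallInterval n := by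
  by_contra hcon
  push Not at hcon
  have hsub : Set.Ioo (0 : ℝ) 1 ⊆ B ∪ ⋃ n, smallInterval n := fun z hz => by
    by_cases hzB : z ∈ B
    · exact Or.inl hzB
    · exact Or.inr (Set.mem_iUnion.2 (hcon z hz hzB))
  have h := (MeasureTheory.measure_mono (μ := MeasureTheory.volume) hsub).trans
    (MeasureTheory.measure_union_le _ _)
  rw [Real.volume_Ioo, hB.measure_zero, zero_add] at h
  have h2 := h.trans volume_iUnion_smallInterval
  rw [ENNReal.ofReal_le_ofReal_iff (by norm_num)] at h2
  norm_num at h2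

open Filter Topology in
/-- The points of the counterexample are new reals of the levels that converge to a real outside of
the model. -/
theorem exists_model_not_HBC : ∃ 𝒜 : Chain, IsGoodChain 𝒜 ∧ ¬ HBC.Sat (𝒜 := 𝒜) Env.nil := by
  choose ca hca using fun n : ℕ => ratOf_surjective (ratOf n - (1 / 2) ^ (n + 3))
  choose cb hcb using fun n : ℕ => ratOf_surjective (ratOf n + (1 / 2) ^ (n + 3))
  obtain ⟨𝒜, h𝒜, hs⟩ := exists_isGoodChain (s := {ca, cb}) (Set.toFinite _).countable
  have hca0 : ca ∈ 𝒜.level 0 := hs (by simp)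
  have hcb0 : cb ∈ 𝒜.level 0 := hs (by simp)
  -- The number `z` is neither rational nor a real of the model.
  obtain ⟨z, hz, hzB, hzO⟩ := exists_notMem_smallInterval
    (B := (⋃ n, values (𝒜.level n)) ∪ Set.range ((↑) : ℚ → ℝ))
    ((Set.countable_iUnion fun n => countable_values (h𝒜.countable n)).union
      (Set.countable_range _))
  simp only [Set.mem_union, Set.mem_iUnion, Set.mem_range, not_or, not_exists] at hzB
  obtain ⟨hzV, hzQ⟩ := hzB
  -- The points `y m` converge to `z`, which is not in the model, and `y m` is new in level `m + 1`.
  have hy : ∀ m : ℕ, ∃ v ∈ ((⋃ n, smallInterval n) ∩ Set.Ioo 0 1) ∩ Metric.ball z (1 / (m + 1)),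
      v ∉ values (𝒜.level m) ∧ ∃ x ∈ 𝒜.level (m + 1), IsFast x ∧ HasValue x v := by
    intro m
    have hpos : (0 : ℝ) < 1 / (m + 1) := by positivity
    refine h𝒜.dense m _ (((isOpen_iUnion fun n => isOpen_Ioo).inter isOpen_Ioo).inter
      Metric.isOpen_ball) ?_
    obtain ⟨q, hq1, hq2⟩ := exists_rat_btwn (show z < min 1 (z + 1 / (m + 1)) from
      lt_min hz.2 (by linarith))
    obtain ⟨c, rfl⟩ := ratOf_surjective q
    -- A rational close to `z` is the centre of one of the intervals.
    refine ⟨ratOf c, ⟨Set.mem_iUnion.2 ⟨c, ?_⟩, hz.1.trans hq1,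
      hq2.trans_le (min_le_left _ _)⟩, ?_⟩
    · have : (0 : ℝ) < (1 / 2) ^ (c + 3) := by positivity
      exact ⟨by linarith, by linarith⟩
    · rw [Metric.mem_ball, Real.dist_eq, abs_lt]
      have := hq2.trans_le (min_le_right _ _)
      exact ⟨by linarith, by linarith⟩
  choose y hyU hynew x hx hxfast hxy using hy
  have hlim : Tendsto y atTop (𝓝 z) := by
    rw [tendsto_iff_dist_tendsto_zero]
    exact squeeze_zero (fun _ => dist_nonneg) (fun m => (Metric.mem_ball.1 (hyU m).2).le)
      tendsto_one_div_add_atTop_nhds_zero_nat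
  obtain ⟨F, hF⟩ := exists_represents (C := Set.range y) h𝒜.isClosedSet fun n => by
    refine ⟨(List.range n).map x, ?_, fun v hv => ?_⟩
    · simp only [List.mem_map, List.mem_range]
      rintro _ ⟨k, hk, rfl⟩
      exact 𝒜.mono (Nat.succ_le_of_lt hk) (hx k)
    · simp only [List.mem_map, List.mem_range, exists_exists_and_eq_and]
      constructor
      · rintro ⟨k, rfl⟩
        refine ⟨k, ?_, hxy k⟩
        by_contra hk
        exact hynew k (values_mono (𝒜.mono (not_lt.1 hk)) hv)
      · rintro ⟨k, -, hk⟩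
        exact ⟨k, (hxy k).unique hk⟩
  refine ⟨𝒜, h𝒜, fun h => ?_⟩
  have hinterval : ∀ {Δ : List Ty} (ρ : Env 𝒜 Δ) (u : Term Δ N1) (a b : Term Δ (N ⇒ N1))
      (n : Term Δ N) (v : ℝ), HasValue (u.eval ρ).toFun v → a.eval ρ = ratSeq ca hca0 →
      b.eval ρ = ratSeq cb hcb0 →
      ((inInterval u a b n).Sat ρ ↔ v ∈ smallInterval (n.eval ρ).toNat) := by
    intro Δ ρ u a b n v hu ha hb
    have h1 := hasValue_const (ca (n.eval ρ).toNat)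
    have h2 := hasValue_const (cb (n.eval ρ).toNat)
    rw [← toFun_ratSeq_app hca0, ← ha, hca] at h1
    rw [← toFun_ratSeq_app hcb0, ← hb, hcb] at h2
    rw [inInterval, Formula.sat_and, sat_realLt (x := a n) h1 hu, sat_realLt (y := b n) hu h2]
    push_cast
    rfl
  obtain ⟨n₀, hn₀⟩ := (Formula.sat_ex _ _).1 (h F
    (sat_isRealFun (C := Set.range y) hF)
    (sat_isClosed (C := Set.range y) hF (by
      intro n v hv hvC
      -- The limit `z` has no code, so that `v` has a positive distance to the compact closure.
      have hK : IsClosed (insert z (Set.range y)) := hlim.isCompact_insert_range.isClosed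
      have hvK : v ∉ insert z (Set.range y) := by
        rintro (rfl | hv')
        · exact hzV n hv
        · exact hvC hv'
      obtain ⟨ε, hε, hball⟩ := Metric.isOpen_iff.1 hK.isOpen_compl v hvK
      refine ⟨ε, hε, fun w hw => ?_⟩
      by_contra hlt
      refine hball (a := w) ?_ (Or.inr hw)
      rw [Metric.mem_ball, Real.dist_eq, abs_sub_comm]
      exact not_le.1 hlt))
    (sat_inUnitInterval (C := Set.range y) hF (by
      rintro _ ⟨m, rfl⟩
      exact Set.Ioo_subset_Icc_self (hyU m).1.2))
    (ratSeq ca hca0) (ratSeq cb hcb0)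
    (fun i => (sat_isReal _ _).2 (isFast_const _))
    (fun i => (sat_isReal _ _).2 (isFast_const _))
    (by
      rw [covers, sat_allReal]
      intro u hu hmem
      obtain ⟨v, hv⟩ := hu.exists_hasValue
      obtain ⟨m, rfl⟩ : v ∈ Set.range y := (sat_mem (by exact hF) (by exact hv)).1 hmem
      obtain ⟨n, hn⟩ := Set.mem_iUnion.1 (hyU m).1.1
      rw [Formula.sat_ex]
      exact ⟨Val.ofNat n, (hinterval _ _ _ _ _ (y m) (by exact hv) (by rfl) (by rfl)).2 hn⟩))
  rw [coversUpTo, sat_allReal] at hn₀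
  -- The endpoints of the intervals are rational, so `z` is not in the closure of any of them.
  have hfar : ∀ n, ∀ᶠ m in atTop, y m ∉ smallInterval n := by
    intro n
    have hzc : z ∉ Set.Icc ((ratOf n : ℝ) - (1 / 2) ^ (n + 3)) (ratOf n + (1 / 2) ^ (n + 3)) := by
      intro hzc
      have h1 : (ratOf n : ℝ) - (1 / 2) ^ (n + 3) ≠ z := fun h =>
        hzQ (ratOf n - (1 / 2) ^ (n + 3)) (by push_cast; exact h)
      have h2 : (ratOf n : ℝ) + (1 / 2) ^ (n + 3) ≠ z := fun h =>
        hzQ (ratOf n + (1 / 2) ^ (n + 3)) (by push_cast; exact h)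
      exact hzO n ⟨lt_of_le_of_ne hzc.1 h1, lt_of_le_of_ne hzc.2 h2.symm⟩
    filter_upwards [hlim (isClosed_Icc.isOpen_compl.mem_nhds hzc)] with m hm hmem
    exact hm (Set.Ioo_subset_Icc_self hmem)
  obtain ⟨m, hm⟩ := ((Finset.eventually_all (Finset.range (n₀.toNat + 1))).2
    fun n _ => hfar n).exists
  have hxm := hn₀ (Val.ofFun (x m) ⟨m + 1, hx m⟩) (hxfast m)
    ((sat_mem (C := Set.range y) (by exact hF) (by exact hxy m)).2 ⟨m, rfl⟩)
  rw [Formula.sat_ex] at hxm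
  obtain ⟨n, hn⟩ := hxm
  rw [Formula.sat_and, Formula.sat_le] at hn
  exact hm n.toNat (Finset.mem_range.2 (Nat.lt_succ_of_le hn.1))
    ((hinterval _ _ _ _ _ (y m) (by exact hxy m) (by rfl) (by rfl)).1 hn.2)

end HOA

/-- The system `Z_2^ω` does not prove `HBC`. -/
theorem theorem3p5 : ¬ HOA.Proves HOA.Z2ω HOA.HBC := by
  intro h
  obtain ⟨𝒜, h𝒜, hnot⟩ := HOA.exists_model_not_HBC
  exact hnot (HOA.Derives.sound (fun _ => h𝒜.sat_Z2ω) h HOA.Env.nil (by simp))
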